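/- Let $S$ be a scheme, let $M$ be an (ordinary) commutative group, and let $G=D_S(M)$ be the associated diagonalizable $S$-group, i.e. the group functor $U\mapsto \mathrm{Hom}_{\mathrm{Gr}}(M,\Gamma(U,\mathcal O_U)^\times)$ on $S$-schemes (represented by $\mathrm{Spec}\,\mathcal O_S[M]$). Let $p:P\to S$ be a scheme affine over $S$, write $P=\mathrm{Spec}\,\mathcal A$ with $\mathcal A=p_*\mathcal O_P$, and suppose that $G$ acts on $P$ on the right, by $S$-morphisms, freely: for every $S$-scheme $U$ the group $G(U)$ acts freely on $P(U)$. The action of $G$ corresponds to an $M$-grading $\mathcal A=\bigoplus_{i\in M}\mathcal A_i$, where $\mathcal A_i$ consists of the sections $a$ with $a(x g)=g(i)\,a(x)$ for all $x\in P(T)$, $g\in G(T)$ and all $S$-schemes $T$. Then the quotient $X=P/G$ exists: there are an $S$-scheme $X$ and a $G$-invariant $S$-morphism $\pi:P\to X$ such that 1. $X$ represents the fpqc quotient sheaf of $P$ by $G$, that is, the functor of points of $X$ is an fpqc sheaf on $S$-schemes and $\pi$ makes it the fpqc sheaf associated with the presheaf $U\mapsto P(U)/G(U)$; if $M$ is finitely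 generated, the same holds for the fppf topology; and $\pi$ is also the quotient of $P$ by $G$ in the category of schemes (every $G$-invariant morphism from $P$ to a scheme factors uniquely through $\pi$); 2. $P$, regarded as an $X$-scheme by $\pi$, is a torsor (for the fpqc topology) under $G_X=G\times_S X$ over $X$, for the action induced by that of $G$; 3. $X$ is affine over $S$. More precisely, $X=\mathrm{Spec}\,\mathcal A^G$: the morphism $\pi$ identifies the direct image of $\mathcal O_X$ on $S$ with the subalgebra $\mathcal A^G\subset\mathcal A$ of $G$-invariants, and $\mathcal A^G=\mathcal A_0$; 4. if $P$ is of finite type (resp. of finite presentation) over $S$, then so is $X$. -/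

import Mathlib

open CategoryTheory Opposite AlgebraicGeometry

universe u

namespace SchemeQuotient

section General

variable {S : Scheme.{u}}

/-- A right action of a group functor `G` over `S` on an `S`-scheme `P`: for every `S`-scheme `U`,
a right action of the group `G(U)` on the set `P(U)` of `S`-morphisms `U ⟶ P`, functorial in `U`.
If `G` is (the functor of points of) a group scheme, this is an action of `G` by Yoneda. -/
structure RightAction (G : (Over S)ᵒᵖ ⥤ GrpCat.{u}) (P : Over S) where
  act : ∀ {U : Over S}, (U ⟶ P) → G.obj (op U) → (U ⟶ P)
  act_one : ∀ {U : Over S} (p : U ⟶ P), act p 1 = p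
  act_mul : ∀ {U : Over S} (p : U ⟶ P) (g h : G.obj (op U)), act p (g * h) = act (act p g) h
  comp_act : ∀ {V U : Over S} (f : V ⟶ U) (p : U ⟶ P) (g : G.obj (op U)),
    f ≫ act p g = act (f ≫ p) (G.map f.op g)

namespace RightAction

variable {G : (Over S)ᵒᵖ ⥤ GrpCat.{u}} {P : Over S} (ρ : RightAction G P)

/-- The action is free: for every `S`-scheme `U`, the group `G(U)` acts freely on `P(U)`. -/
def IsFree : Prop :=
  ∀ ⦃U : Over S⦄ (p : U ⟶ P) (g : G.obj (op U)), ρ.act p g = p → g = 1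

/-- A morphism of `S`-schemes `π : P ⟶ X` is `G`-invariant if `π (p g) = π p`. -/
def IsInvariant {X : Over S} (π : P ⟶ X) : Prop :=
  ∀ ⦃U : Over S⦄ (p : U ⟶ P) (g : G.obj (op U)), ρ.act p g ≫ π = p ≫ π

/-- `p` and `q` in `P(U)` are equivalent if they lie in the same `G(U)`-orbit. -/
def orbitSetoid (U : Over S) : Setoid (U ⟶ P) where
  r p q := ∃ g : G.obj (op U), ρ.act p g = q
  iseqv :=
    { refl := fun p => ⟨1, ρ.act_one p⟩
      symm := by
        rintro p _ ⟨g, rfl⟩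
        exact ⟨g⁻¹, by rw [← ρ.act_mul, mul_inv_cancel, ρ.act_one]⟩
      trans := by
        rintro p _ _ ⟨g, rfl⟩ ⟨h, rfl⟩
        exact ⟨g * h, ρ.act_mul p g h⟩ }

/-- The presheaf of orbits `U ↦ P(U)/G(U)` on the category of `S`-schemes. -/
def orbitPresheaf : (Over S)ᵒᵖ ⥤ Type u where
  obj U := Quotient (ρ.orbitSetoid U.unop)
  map {U V} f := TypeCat.ofHom (Quotient.map (fun p => f.unop ≫ p) (by
    rintro p _ ⟨g, rfl⟩
    exact ⟨G.map f g, (ρ.comp_act f.unop p g).symm⟩))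
  map_id U := by
    ext x
    induction x using Quotient.inductionOn with
    | h p => exact congrArg (Quotient.mk _) (Category.id_comp p)
  map_comp {U V W} f g := by
    ext x
    induction x using Quotient.inductionOn with
    | h p => exact congrArg (Quotient.mk _) (Category.assoc g.unop f.unop p)

/-- The morphism from the presheaf of orbits to the functor of points of `X` given by an invariant
morphism `π : P ⟶ X`. -/
def orbitPresheafTo {X : Over S} (π : P ⟶ X) (hπ : ρ.IsInvariant π) :
    ρ.orbitPresheaf ⟶ yoneda.obj X where
  app U := TypeCat.ofHom (Quotient.lift (fun p => p ≫ π) (by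
    rintro p _ ⟨g, rfl⟩
    exact (hπ p g).symm))
  naturality {U V} f := by
    ext x
    induction x using Quotient.inductionOn with
    | h p => exact Category.assoc f.unop p π

/-- `X`, with the invariant morphism `π : P ⟶ X`, represents the quotient sheaf `P/G` for the
topology `J`: the functor of points of `X` is a `J`-sheaf, and it is the sheaf associated with the
presheaf `U ↦ P(U)/G(U)`, i.e. two sections of that presheaf have the same image in `X(U)` if and
only if they are locally equal, and each section of `X` comes locally from a section of it. -/
structure RepresentsQuotientSheaf (J : GrothendieckTopology (Over S)) {X : Over S} (π : P ⟶ X)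
    (hπ : ρ.IsInvariant π) : Prop where
  isSheaf : Presheaf.IsSheaf J (yoneda.obj X)
  locallyInjective : Presheaf.IsLocallyInjective J (ρ.orbitPresheafTo π hπ)
  locallySurjective : Presheaf.IsLocallySurjective J (ρ.orbitPresheafTo π hπ)

/-- `π : P ⟶ X` is a quotient of `P` by `G` in the category of schemes: it is invariant, and
universal among the invariant morphisms from `P` to a scheme. -/
def IsCategoricalQuotient {X : Over S} (π : P ⟶ X) : Prop :=
  ρ.IsInvariant π ∧
    ∀ (Z : Scheme.{u}) (v : P.left ⟶ Z),
      (∀ ⦃U : Over S⦄ (p : U ⟶ P) (g : G.obj (op U)), (ρ.act p g).left ≫ v = p.left ≫ v) →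
      ∃! w : X.left ⟶ Z, π.left ≫ w = v

/-- `P` is a `G`-torsor over `S` for the fpqc topology: for every `S`-scheme `U` the group `G(U)`
acts simply transitively on `P(U)` as soon as the latter is nonempty, and `P` has sections over the
members of some fpqc covering family of `S`. -/
def IsFpqcTorsor : Prop :=
  (∀ ⦃U : Over S⦄ (p q : U ⟶ P), ∃! g : G.obj (op U), ρ.act p g = q) ∧
    ∃ R ∈ Scheme.fpqcPrecoverage S, ∀ ⦃U : Scheme.{u}⦄ (f : U ⟶ S), R f →
      Nonempty (Over.mk f ⟶ P)

/-- The group functor `G_X = G ×_S X` over `X`: its value on an `X`-scheme `V` is `G(V)`, where `V`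
is regarded as an `S`-scheme. -/
abbrev baseChangeGroup (G : (Over S)ᵒᵖ ⥤ GrpCat.{u}) (X : Over S) :
    (Over X.left)ᵒᵖ ⥤ GrpCat.{u} :=
  (Over.map X.hom).op ⋙ G

/-- `P` as an `X`-scheme, by means of `π : P ⟶ X`. -/
abbrev overQuotient {X : Over S} (π : P ⟶ X) : Over X.left := Over.mk π.left

/-- A morphism of `X`-schemes `V ⟶ P`, as a morphism of `S`-schemes. -/
def forgetBase {X : Over S} (π : P ⟶ X) {V : Over X.left} (p : V ⟶ overQuotient π) :
    (Over.map X.hom).obj V ⟶ P :=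
  Over.homMk p.left (by
    have h : p.left ≫ π.left = V.hom := Over.w p
    have h' : π.left ≫ X.hom = P.hom := Over.w π
    change p.left ≫ P.hom = V.hom ≫ X.hom
    rw [← h', ← h, Category.assoc])

/-- The action of `G_X` on the `X`-scheme `P` induced by the action of `G` on `P`, for a
`G`-invariant morphism `π : P ⟶ X`. -/
def overInvariant {X : Over S} (π : P ⟶ X) (hπ : ρ.IsInvariant π) :
    RightAction (baseChangeGroup G X) (overQuotient π) where
  act {V} p g := Over.homMk (ρ.act (forgetBase π p) g).left (by
    have h : (ρ.act (forgetBase π p) g).left ≫ π.left = p.left ≫ π.left :=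
      congrArg Over.Hom.left (hπ (forgetBase π p) g)
    exact h.trans (Over.w p))
  act_one {V} p := by
    apply Over.OverMorphism.ext
    have e := congrArg (fun f => Over.Hom.left f) (ρ.act_one (forgetBase π p))
    exact e
  act_mul {V} p g h := by
    apply Over.OverMorphism.ext
    have e := congrArg (fun f => Over.Hom.left f) (ρ.act_mul (forgetBase π p) g h)
    exact e
  comp_act {V W} f p g := by
    apply Over.OverMorphism.ext
    have e := congrArg (fun f => Over.Hom.left f) (ρ.comp_act ((Over.map X.hom).map f) (forgetBase π p) g)
    exact e

/-- The pullback along `p : T ⟶ P` of a section `a` of the structure sheaf of `P` over the inverse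
image of the open subset `U` of `S`. -/
def pullSection {T : Over S} (p : T ⟶ P) (U : S.Opens) (a : Γ(P.left, P.hom ⁻¹ᵁ U)) :
    Γ(T.left, T.hom ⁻¹ᵁ U) :=
  p.left.appLE (P.hom ⁻¹ᵁ U) (T.hom ⁻¹ᵁ U)
    (by rw [← Scheme.Hom.comp_preimage, Over.w p]) a

/-- The `G`-invariant sections over `U` of the `𝒪_S`-algebra `𝒜` which is the direct image on `S`
of the structure sheaf of `P`: the sections `a` with `a(p g) = a(p)` for all points `p` of `P` and
`g` of `G` with values in an `S`-scheme. -/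
def invariantSections (U : S.Opens) : Set Γ(P.left, P.hom ⁻¹ᵁ U) :=
  {a | ∀ ⦃T : Over S⦄ (p : T ⟶ P) (g : G.obj (op T)),
    pullSection (ρ.act p g) U a = pullSection p U a}

end RightAction

end General

section Diagonalizable

/-- The diagonalizable group `D_S(M)` over `S` of an ordinary commutative group `M`, as a functor:
`D_S(M)(U) = Hom(M, Γ(U, 𝒪_U)ˣ)`. -/
def diagonalizableGroup (S : Scheme.{u}) (M : Type u) [AddCommGroup M] :
    (Over S)ᵒᵖ ⥤ GrpCat.{u} where
  obj U := GrpCat.of (Multiplicative M →* Γ(U.unop.left, ⊤)ˣ)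
  map {U V} f := GrpCat.ofHom
    { toFun := fun g =>
        (Units.map (f.unop.left.appTop.hom : Γ(U.unop.left, ⊤) →* Γ(V.unop.left, ⊤))).comp g
      map_one' := MonoidHom.comp_one _
      map_mul' := fun g h => MonoidHom.comp_mul _ g h }
  map_id U := by
    refine GrpCat.hom_ext (MonoidHom.ext fun g => MonoidHom.ext fun m => Units.ext ?_)
    change (Scheme.Hom.appTop (𝟙 U.unop.left)).hom _ = _
    simp
  map_comp {U V W} f h := by
    refine GrpCat.hom_ext (MonoidHom.ext fun g => MonoidHom.ext fun m => Units.ext ?_)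
    change (Scheme.Hom.appTop (h.unop.left ≫ f.unop.left)).hom _ = _
    rw [Scheme.Hom.comp_appTop]
    rfl

variable {S : Scheme.{u}} {M : Type u} [AddCommGroup M] {P : Over S}

/-- The component of degree `i` over `U` of the `M`-grading, defined by an action of `D_S(M)` on
`P`, of the direct image `𝒜` of the structure sheaf of `P` on `S`: the sections `a` such that
`a(p g) = g(i) a(p)` for all points `p` of `P` and `g` of `D_S(M)` with values in an `S`-scheme. -/
def gradedPiece (ρ : RightAction (diagonalizableGroup S M) P) (i : M) (U : S.Opens) :
    Set Γ(P.left, P.hom ⁻¹ᵁ U) :=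
  {a | ∀ ⦃T : Over S⦄ (p : T ⟶ P) (g : Multiplicative M →* Γ(T.left, ⊤)ˣ),
    RightAction.pullSection (ρ.act p g) U a =
      T.left.presheaf.map (homOfLE le_top).op (g (Multiplicative.ofAdd i) : Γ(T.left, ⊤)) *
        RightAction.pullSection p U a}

end Diagonalizable

/-- Morphisms of finite type. -/
def IsOfFiniteType {X Y : Scheme.{u}} (f : X ⟶ Y) : Prop :=
  LocallyOfFiniteType f ∧ QuasiCompact f

/-- Morphisms of finite presentation. -/
def IsOfFinitePresentation {X Y : Scheme.{u}} (f : X ⟶ Y) : Prop :=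
  LocallyOfFinitePresentation f ∧ QuasiCompact f ∧ QuasiSeparated f

end SchemeQuotient

/-! Over an affine open subset of `S`, with `A` the ring of sections of `P`, Yoneda at the universal
point with values in `A[M]` turns the action into a coaction `A → A[M]`, that is, an `M`-grading of
`A`. Everything rests on one fact (`isStrong_coaction`): if the action is free, the grading is
strong, meaning that `1` is a finite sum of products `a_k b_k` with `a_k ∈ A_i` and `b_k ∈ A_{-i}`,
for every `i`. Otherwise `A_i A_{-i}` lies in a maximal ideal `n` of `A_0`. The degrees `j` with
`A_j A_{-j} ⊄ n` form a subgroup `M'` not containing `i`, the pieces of degree outside `M'` generate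
a proper ideal `J`, and the tautological character of `M/M'` with values in `(A/J)[M/M']` is
nontrivial and fixes the point `A → A/J`.

The relations `1 = ∑ a_k b_k` give the rest. They make `A` a projective `A_0`-module, and the
projection onto `A_0` makes `Spec A → Spec A_0` surjective, so `A_0 → A` is faithfully flat. Two
homomorphisms `p`, `q` from `A` which agree on `A_0` differ by the character `i ↦ ∑ q(a_k) p(b_k)`,
so the fibres of the quotient map are orbits. They also yield `A ⊗_{A_0} A ≃ A[M]`, whence `A` is
finitely presented over `A_0` by descent when `M` is finitely generated.

Taking degree-zero parts commutes with localization on the base, so the spectra of the rings `A_0`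
glue to a scheme `X` affine over `S`. The map `π : P → X` is flat, surjective and quasi-compact: it
is an fpqc covering and an effective epimorphism, and since its fibres are orbits, `X` is both the
sheaf quotient and the categorical quotient. Finiteness over the base is separate and needs only the
grading: a graded polynomial presentation of `A` restricts to a presentation of `A_0`, and Dickson's
lemma keeps the relations finite in number. -/

namespace SchemeQuotient

/-! ### Gradings as coactions; freeness forces a strong grading. -/

section

/-- A coaction of the group algebra `ℤ[M]` on a commutative ring `A`, written as a ring
homomorphism `A → A[M]` which is counital and coassociative. It is the same as an `M`-grading
of `A`. -/
structure GroupAlgebraCoaction (A M : Type*) [CommRing A] [AddCommGroup M] where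
  hom : A →+* AddMonoidAlgebra A M
  sum_hom : ∀ a, (hom a).coeff.sum (fun _ x => x) = a
  hom_coeff : ∀ a i, hom ((hom a).coeff i) = AddMonoidAlgebra.single i ((hom a).coeff i)

namespace GroupAlgebraCoaction

variable {A M : Type*} [CommRing A] [AddCommGroup M] (c : GroupAlgebraCoaction A M)

/-- The homogeneous elements of degree `i`. -/
def piece (i : M) : AddSubgroup A where
  carrier := {a | c.hom a = AddMonoidAlgebra.single i a}
  zero_mem' := by simp
  add_mem' {a b} ha hb := by
    simp only [Set.mem_ofPred_eq] at *
    rw [map_add, ha, hb, AddMonoidAlgebra.single_add]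
  neg_mem' {a} ha := by
    simp only [Set.mem_ofPred_eq] at *
    rw [map_neg, ha, AddMonoidAlgebra.single_neg]

/-- The component of degree `i`. -/
noncomputable def proj (i : M) : A →+ A where
  toFun a := (c.hom a).coeff i
  map_zero' := by simp
  map_add' a b := by simp

/-- The subring of elements of degree zero. -/
def inv : Subring A where
  carrier := {a | c.hom a = AddMonoidAlgebra.single 0 a}
  zero_mem' := (c.piece 0).zero_mem
  add_mem' := (c.piece 0).add_mem
  neg_mem' := (c.piece 0).neg_mem
  one_mem' := by
    simp only [Set.mem_ofPred_eq, map_one]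
    rfl
  mul_mem' {a b} ha hb := by
    simp only [Set.mem_ofPred_eq] at *
    rw [map_mul, ha, hb, AddMonoidAlgebra.single_mul_single, add_zero]

variable {c}

lemma mem_piece {i : M} {a : A} : a ∈ c.piece i ↔ c.hom a = AddMonoidAlgebra.single i a := Iff.rfl

lemma mem_inv {a : A} : a ∈ c.inv ↔ a ∈ c.piece 0 := Iff.rfl

lemma one_mem : (1 : A) ∈ c.piece 0 := c.inv.one_mem

lemma mul_mem {i j : M} {a b : A} (ha : a ∈ c.piece i) (hb : b ∈ c.piece j) :
    a * b ∈ c.piece (i + j) := by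
  rw [mem_piece] at *
  rw [map_mul, ha, hb, AddMonoidAlgebra.single_mul_single]

lemma mul_mem_inv {i : M} {a b : A} (ha : a ∈ c.piece i) (hb : b ∈ c.piece (-i)) :
    a * b ∈ c.inv := by
  simpa [mem_inv] using mul_mem ha hb

lemma proj_mem (i : M) (a : A) : c.proj i a ∈ c.piece i := c.hom_coeff a i

lemma proj_same {i : M} {a : A} (ha : a ∈ c.piece i) : c.proj i a = a := by
  change (c.hom a).coeff i = a
  rw [mem_piece.mp ha]
  simp

lemma proj_of_ne {i j : M} (hij : j ≠ i) {a : A} (ha : a ∈ c.piece i) : c.proj j a = 0 := by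
  change (c.hom a).coeff j = 0
  rw [mem_piece.mp ha, AddMonoidAlgebra.coeff_single, Finsupp.single_eq_of_ne hij]

lemma proj_mul_of_mem {i j : M} {a b : A} (hb : b ∈ c.piece j) :
    c.proj i (a * b) = c.proj (i - j) a * b := by
  change (c.hom (a * b)).coeff i = (c.hom a).coeff (i - j) * b
  rw [map_mul, mem_piece.mp hb]
  exact AddMonoidAlgebra.coeff_mul_single_eq_coeff_mul _ fun m _ => eq_sub_iff_add_eq.symm

lemma sum_proj (a : A) : ∑ i ∈ (c.hom a).coeff.support, c.proj i a = a := c.sum_hom a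

@[elab_as_elim]
lemma induction_on {p : A → Prop} (a : A) (homogeneous : ∀ i, ∀ x ∈ c.piece i, p x)
    (add : ∀ x y, p x → p y → p (x + y)) : p a := by
  rw [← c.sum_proj a]
  exact Finset.sum_induction _ p add (homogeneous 0 0 (zero_mem _))
    fun i _ => homogeneous i _ (proj_mem i a)

variable (c)

/-- The projection onto the elements of degree zero. -/
noncomputable def projInv : A →ₗ[c.inv] c.inv where
  toFun a := ⟨c.proj 0 a, proj_mem 0 a⟩
  map_add' a b := Subtype.ext (by simp)
  map_smul' r a := Subtype.ext (by
    change c.proj 0 (r.1 * a) = r.1 * c.proj 0 a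
    rw [mul_comm, proj_mul_of_mem (j := 0) r.2, sub_zero, mul_comm])

lemma projInv_apply_coe (r : c.inv) : c.projInv r.1 = r := Subtype.ext (proj_same r.2)

/-- The grading is strong: the products `A_i A_{-i}` generate the unit ideal of `A_0`. -/
def IsStrong : Prop :=
  ∀ i, ∃ (n : ℕ) (a b : Fin n → A), (∀ k, a k ∈ c.piece i) ∧ (∀ k, b k ∈ c.piece (-i)) ∧
    ∑ k, a k * b k = 1

lemma isStrong_of_span_eq_top
    (h : ∀ i, Ideal.span {x : c.inv | ∃ a ∈ c.piece i, ∃ b ∈ c.piece (-i), x.1 = a * b} = ⊤) :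
    c.IsStrong := by
  intro i
  have h1 := (Ideal.eq_top_iff_one _).mp (h i)
  obtain ⟨n, r, g, hg⟩ := Submodule.mem_span_set'.mp h1
  choose a ha b hb hab using fun k => (g k).2
  refine ⟨n, fun k => (r k).1 * a k, b, fun k => ?_, hb, ?_⟩
  · simpa using mul_mem (mem_inv.mp (r k).2) (ha k)
  · have := congrArg Subtype.val hg
    rw [AddSubmonoidClass.coe_finsetSum] at this
    rw [← show ((1 : c.inv) : A) = 1 from rfl, ← this]
    refine Finset.sum_congr rfl fun k _ => ?_
    rw [mul_assoc, ← hab]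
    rfl

/-- The subgroup of the degrees `i` such that `A_i A_{-i}` is not contained in a prime ideal. -/
def degreesAt (n : Ideal c.inv) [n.IsPrime] : AddSubgroup M where
  carrier := {i | ∃ a, ∃ ha : a ∈ c.piece i, ∃ b, ∃ hb : b ∈ c.piece (-i),
    (⟨a * b, mul_mem_inv ha hb⟩ : c.inv) ∉ n}
  zero_mem' := ⟨1, one_mem, 1, by simpa using one_mem, by
    intro h
    refine (Ideal.ne_top_iff_one n).mp (Ideal.IsPrime.ne_top inferInstance) ?_
    rwa [show (⟨1 * 1, _⟩ : c.inv) = 1 from Subtype.ext (mul_one 1)] at h⟩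
  add_mem' := by
    rintro i j ⟨a, ha, b, hb, hab⟩ ⟨a', ha', b', hb', hab'⟩
    refine ⟨a * a', mul_mem ha ha', b * b', by simpa [add_comm] using mul_mem hb hb', fun h => ?_⟩
    refine (Ideal.IsPrime.mem_or_mem inferInstance (x := (⟨a * b, mul_mem_inv ha hb⟩ : c.inv))
      (y := ⟨a' * b', mul_mem_inv ha' hb'⟩) ?_).elim hab hab'
    convert h using 1
    exact Subtype.ext (by change a * b * (a' * b') = a * a' * (b * b'); ring)
  neg_mem' := by
    rintro i ⟨a, ha, b, hb, hab⟩
    refine ⟨b, hb, a, by simpa using ha, fun h => hab ?_⟩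
    convert h using 1
    exact Subtype.ext (mul_comm a b)

/-- If `x` has degree `i` outside `degreesAt n`, the degree-zero part of `y * x` is the component of
`y` of degree `-i` times `x`, which lies in `n`. So the whole ideal has degree-zero parts in `n`,
and `1` is not in `n`. -/
lemma span_ne_top (n : Ideal c.inv) [n.IsPrime] :
    Ideal.span {x : A | ∃ i ∉ c.degreesAt n, x ∈ c.piece i} ≠ ⊤ := by
  rw [Ideal.ne_top_iff_one]
  intro h
  have key : ∀ x ∈ Ideal.span {x : A | ∃ i ∉ c.degreesAt n, x ∈ c.piece i},
      ∀ y, c.projInv (y * x) ∈ n := by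
    intro x hx
    induction hx using Submodule.span_induction with
    | mem x hx =>
      obtain ⟨i, hi, hx⟩ := hx
      intro y
      by_contra hn
      refine hi ⟨x, hx, c.proj (-i) y, proj_mem _ _, ?_⟩
      convert hn using 2
      refine Subtype.ext ?_
      change x * c.proj (-i) y = c.proj 0 (y * x)
      rw [proj_mul_of_mem hx, zero_sub, mul_comm]
    | zero => simp
    | add x x' _ _ hx hx' =>
      intro y
      rw [mul_add, map_add]
      exact n.add_mem (hx y) (hx' y)
    | smul r x _ hx =>
      intro y
      rw [smul_eq_mul, ← mul_assoc]
      exact hx _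
  have := key 1 h 1
  rw [mul_one, show (1 : A) = (1 : c.inv).1 from rfl, projInv_apply_coe] at this
  exact (Ideal.ne_top_iff_one n).mp (Ideal.IsPrime.ne_top inferInstance) this

/-- If the grading is not strong, a nontrivial character acts trivially on some point. -/
lemma isStrong_of_forall_eq_one {A M : Type u} [CommRing A] [AddCommGroup M]
    (c : GroupAlgebraCoaction A M)
    (h : ∀ (B : Type u) [CommRing B] (φ : A →+* B) (g : Multiplicative M →* Bˣ),
      (∀ i, ∀ a ∈ c.piece i, (g (Multiplicative.ofAdd i) : B) * φ a = φ a) → g = 1) :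
    c.IsStrong := by
  refine c.isStrong_of_span_eq_top fun i => ?_
  by_contra hne
  obtain ⟨n, hn, hle⟩ := Ideal.exists_le_maximal _ hne
  have := hn.isPrime
  set J := Ideal.span {x : A | ∃ i ∉ c.degreesAt n, x ∈ c.piece i} with hJ
  have hJt : J ≠ ⊤ := c.span_ne_top n
  have : Nontrivial (A ⧸ J) := Ideal.Quotient.nontrivial_iff.mpr hJt
  -- The point `φ` kills the pieces whose degree is outside `degreesAt n`, and the character `g` is
  -- trivial on `degreesAt n`. So `g` fixes `φ`, and `g = 1` forces `i` into `degreesAt n`, against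
  -- `A_i A_{-i} ⊆ n`.
  let Q := M ⧸ c.degreesAt n
  let B := AddMonoidAlgebra (A ⧸ J) Q
  let φ : A →+* B := (AddMonoidAlgebra.singleZeroRingHom).comp (Ideal.Quotient.mk J)
  let g : Multiplicative M →* Bˣ := ((AddMonoidAlgebra.of (A ⧸ J) Q).comp
    (AddMonoidHom.toMultiplicative (QuotientAddGroup.mk' (c.degreesAt n)))).toHomUnits
  have hg : ∀ j, (g (Multiplicative.ofAdd j) : B) =
      AddMonoidAlgebra.single (QuotientAddGroup.mk j : Q) 1 := fun j => rfl
  have hφ : ∀ a, φ a = AddMonoidAlgebra.single 0 (Ideal.Quotient.mk J a) := fun a => rfl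
  have h1 := h B φ g (by
    intro j a ha
    rw [hg, hφ]
    by_cases hj : j ∈ c.degreesAt n
    · rw [(QuotientAddGroup.eq_zero_iff j).mpr hj, AddMonoidAlgebra.single_mul_single, zero_add,
        one_mul]
    · have : Ideal.Quotient.mk J a = 0 :=
        Ideal.Quotient.eq_zero_iff_mem.mpr (Ideal.subset_span ⟨j, hj, ha⟩)
      rw [this, AddMonoidAlgebra.single_zero, mul_zero])
  have h2 := hg i
  rw [h1] at h2
  have h3 : (QuotientAddGroup.mk i : Q) = 0 := by
    by_contra h0
    have h4 := congrArg (fun x : B => x.coeff 0) h2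
    have h5 : (AddMonoidAlgebra.single (QuotientAddGroup.mk i : Q) (1 : A ⧸ J)).coeff 0 = 0 := by
      rw [AddMonoidAlgebra.coeff_single, Finsupp.single_eq_of_ne' h0]
    have h6 : (1 : B).coeff 0 = 1 := by
      change (AddMonoidAlgebra.single (0 : Q) (1 : A ⧸ J)).coeff 0 = 1
      simp
    exact one_ne_zero (h6.symm.trans (h4.trans h5))
  obtain ⟨a, ha, b, hb, hab⟩ := (QuotientAddGroup.eq_zero_iff i).mp h3
  exact hab (hle (Ideal.subset_span ⟨a, ha, b, hb, rfl⟩))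

end GroupAlgebraCoaction

end

/-! ### Strong gradings: faithful flatness and transitivity on fibres. -/

section

namespace GroupAlgebraCoaction

open TensorProduct

variable {A M : Type*} [CommRing A] [AddCommGroup M] {c : GroupAlgebraCoaction A M}

/-- The coaction as a linear map over the elements of degree zero. -/
noncomputable def homLinear (c : GroupAlgebraCoaction A M) : A →ₗ[c.inv] M →₀ A where
  toFun a := (c.hom a).coeff
  map_add' a b := by simp
  map_smul' r a := by
    ext i
    change c.proj i (r.1 * a) = r.1 * c.proj i a
    rw [mul_comm, proj_mul_of_mem (j := 0) r.2, sub_zero, mul_comm]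

/-- A dual basis: the `a i k` are the generators, and the coordinates of `x` are the products of its
component of degree `i` with `b i k`. For `x` of degree `i` this reads `x = ∑ (x b_k) a_k`, with `x
b_k` of degree zero. -/
lemma IsStrong.projective (hc : c.IsStrong) : Module.Projective c.inv A := by
  choose n a b ha hb hab using hc
  let s : A →ₗ[c.inv] ((Σ i, Fin (n i)) →₀ c.inv) :=
    (Finsupp.lsum ℕ fun i => ∑ k, (Finsupp.lsingle ⟨i, k⟩).comp
      (c.projInv.comp (LinearMap.mulRight c.inv (b i k)))).comp c.homLinear
  let t : ((Σ i, Fin (n i)) →₀ c.inv) →ₗ[c.inv] A :=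
    Finsupp.linearCombination c.inv fun x : Σ i, Fin (n i) => a x.1 x.2
  refine .of_split s t (LinearMap.ext fun x => ?_)
  induction x using c.induction_on with
  | add x y hx hy => rw [map_add, hx, hy, map_add]
  | homogeneous i x hx =>
    have h1 : c.homLinear x = Finsupp.single i x := by
      change (c.hom x).coeff = _
      rw [mem_piece.mp hx]
      rfl
    have h2 : ∀ k, (c.projInv (x * b i k) : A) = x * b i k :=
      fun k => proj_same (mul_mem_inv hx (hb i k))
    simp only [s, t, LinearMap.comp_apply, h1, Finsupp.lsum_single, LinearMap.sum_apply, map_sum,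
      Finsupp.lsingle_apply, Finsupp.linearCombination_single, LinearMap.mulRight_apply,
      Subring.smul_def, h2, LinearMap.id_apply, smul_eq_mul]
    conv_rhs => rw [← mul_one x, ← hab i, Finset.mul_sum]
    exact Finset.sum_congr rfl fun k _ => by ring

/-- The projection onto degree zero is an `A_0`-linear retraction, so `pA ∩ A_0 = p` for every prime
`p` of `A_0`. Any grading will do here, strong or not. -/
lemma comap_surjective : Function.Surjective (PrimeSpectrum.comap (algebraMap c.inv A)) := by
  intro p
  have h : (p.asIdeal.map (algebraMap c.inv A)).comap (algebraMap c.inv A) = p.asIdeal := by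
    refine le_antisymm (fun x hx => ?_) Ideal.le_comap_map
    have key : ∀ y ∈ p.asIdeal.map (algebraMap c.inv A), ∀ z, c.projInv (z * y) ∈ p.asIdeal := by
      intro y hy
      induction hy using Submodule.span_induction with
      | mem y hy =>
        obtain ⟨r, hr, rfl⟩ := hy
        intro z
        rw [mul_comm]
        change c.projInv (r • z) ∈ _
        rw [map_smul]
        exact p.asIdeal.mul_mem_right _ hr
      | zero => simp
      | add y y' _ _ hy hy' =>
        intro z
        rw [mul_add, map_add]
        exact p.asIdeal.add_mem (hy z) (hy' z)
      | smul r y _ hy =>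
        intro z
        rw [smul_eq_mul, ← mul_assoc]
        exact hy _
    have := key _ hx 1
    rw [one_mul] at this
    rwa [← c.projInv_apply_coe x]
  obtain ⟨q, hq, hqp⟩ := (Ideal.comap_map_eq_self_iff_of_isPrime p.asIdeal).mp h
  exact ⟨⟨q, hq⟩, PrimeSpectrum.ext hqp⟩

lemma IsStrong.faithfullyFlat (hc : c.IsStrong) : c.inv.subtype.FaithfullyFlat := by
  have := hc.projective
  change (algebraMap c.inv A).FaithfullyFlat
  rw [RingHom.FaithfullyFlat.iff_flat_and_comap_surjective]
  exact ⟨RingHom.flat_algebraMap_iff.mpr inferInstance, comap_surjective⟩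

/-- Two points with the same image in the quotient differ by a unique character. -/
lemma IsStrong.existsUnique_monoidHom (hc : c.IsStrong) {C : Type*} [CommRing C] (p q : A →+* C)
    (h : ∀ a ∈ c.inv, p a = q a) :
    ∃! g : Multiplicative M →* C,
      ∀ i, ∀ x ∈ c.piece i, q x = g (Multiplicative.ofAdd i) * p x := by
  choose n a b ha hb hab using hc
  -- a finite sum which determines the value of the character in degree `i`
  have uniq : ∀ i (s t : C), (∀ x ∈ c.piece i, s * p x = t * p x) → s = t := by
    intro i s t hst
    rw [← mul_one s, ← mul_one t, ← map_one p, ← hab i, map_sum, Finset.mul_sum, Finset.mul_sum]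
    refine Finset.sum_congr rfl fun k _ => ?_
    rw [map_mul, ← mul_assoc, hst _ (ha i k), mul_assoc]
  -- The only possible value: if `q = g(i) p` on `A_i`, then `∑ q(a_k) p(b_k) = g(i) p(∑ a_k b_k) =
  -- g(i)`.
  let γ : M → C := fun i => ∑ k, q (a i k) * p (b i k)
  have hγ : ∀ i, ∀ x ∈ c.piece i, q x = γ i * p x := by
    intro i x hx
    conv_lhs => rw [← mul_one x, ← hab i, Finset.mul_sum, map_sum]
    rw [Finset.sum_mul]
    refine Finset.sum_congr rfl fun k _ => ?_
    rw [mul_left_comm, map_mul, ← h (x * b i k) (mul_mem_inv hx (hb i k)), map_mul]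
    ring
  refine ⟨⟨⟨fun i => γ i.toAdd, ?_⟩, ?_⟩, hγ, ?_⟩
  · refine uniq 0 _ _ fun x hx => ?_
    change γ 0 * _ = _
    rw [← hγ 0 x hx, one_mul, h x hx]
  · intro i j
    refine uniq (i.toAdd + j.toAdd) _ _ fun x hx => ?_
    change γ (i.toAdd + j.toAdd) * _ = γ i.toAdd * γ j.toAdd * _
    rw [← hγ _ x hx]
    have hx1 : x = ∑ k, x * (a i.toAdd k * b i.toAdd k) := by
      rw [← Finset.mul_sum, hab, mul_one]
    rw [hx1, map_sum, map_sum, Finset.mul_sum]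
    refine Finset.sum_congr rfl fun k _ => ?_
    have hm : x * b i.toAdd k ∈ c.piece j.toAdd := by
      simpa using mul_mem hx (hb i.toAdd k)
    rw [mul_left_comm, map_mul, hγ _ _ hm, hγ _ _ (ha i.toAdd k), map_mul, map_mul, map_mul]
    ring
  · intro g hg
    refine MonoidHom.ext fun i => uniq i.toAdd _ _ fun x hx => ?_
    change _ = γ i.toAdd * _
    rw [← hγ _ x hx, hg _ x hx]
    rfl

end GroupAlgebraCoaction

end

/-! ### Finite presentation of `A` over `A_0`, and of `A_0` over the base. -/

section

/-- The algebra of a finitely generated commutative monoid is finitely presented. -/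
lemma finitePresentation_addMonoidAlgebra (R K : Type*) [CommRing R] [AddCommMonoid K]
    [AddMonoid.FG K] : Algebra.FinitePresentation R (AddMonoidAlgebra R K) := by
  have : Algebra.FinitePresentation ℤ (AddMonoidAlgebra ℤ K) :=
    Algebra.FinitePresentation.of_finiteType.mp (AddMonoidAlgebra.finiteType_of_fg ℤ K)
  exact Algebra.FinitePresentation.equiv (AddMonoidAlgebra.scalarTensorEquiv ℤ (M := K) R)

/-- Dickson's lemma for the fibre of a homomorphism: it has finitely many minimal elements. -/
lemma finite_minimal_fiber {σ M : Type*} [Finite σ] [AddCommGroup M] (d : (σ →₀ ℕ) →+ M) (e : M) :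
    {m | Minimal (fun m => d m = e) m}.Finite :=
  WellQuasiOrderedLE.finite_of_isAntichain (setOfPred_minimal_antichain _)

namespace GroupAlgebraCoaction

open TensorProduct

variable {A M : Type*} [CommRing A] [AddCommGroup M] {c : GroupAlgebraCoaction A M}

/-- After base change along the faithfully flat `A_0 → A`, the algebra `A` becomes `A[M]` through `a
⊗ x ↦ a δ(x)`, where `δ` is the coaction. Finite presentation of `A[M]` over `A` then descends. -/
lemma IsStrong.finitePresentation (hc : c.IsStrong) [AddMonoid.FG M] :
    c.inv.subtype.FinitePresentation := by
  have hff := hc.faithfullyFlat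
  change (algebraMap c.inv A).FaithfullyFlat at hff
  rw [RingHom.faithfullyFlat_algebraMap_iff] at hff
  let δ : A →ₐ[c.inv] AddMonoidAlgebra A M :=
    { c.hom with commutes' := fun r => r.2 }
  let f : A ⊗[c.inv] A →ₐ[A] AddMonoidAlgebra A M :=
    Algebra.TensorProduct.lift (Algebra.ofId A _) δ fun _ _ => Commute.all _ _
  have hf : ∀ (i : M) (a x : A), x ∈ c.piece i →
      f (a ⊗ₜ x) = AddMonoidAlgebra.single i (a * x) := by
    intro i a x hx
    have h1 : δ x = AddMonoidAlgebra.single i x := hx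
    simp only [f, Algebra.TensorProduct.lift_tmul, h1, Algebra.ofId_apply]
    rw [← Algebra.smul_def, AddMonoidAlgebra.smul_single, smul_eq_mul]
  choose n a b ha hb hab using hc
  -- The inverse sends `x` in degree `i` to `∑ x a_k ⊗ b_k`. The relation is taken in degree `-i`,
  -- so that the right-hand factors `b_k` have degree `i`, as those of a preimage must.
  let g : AddMonoidAlgebra A M →+ A ⊗[c.inv] A :=
    (Finsupp.liftAddHom fun i => ∑ k,
      ((TensorProduct.mk c.inv A A).flip (b (-i) k)).toAddMonoidHom.comp
      (AddMonoidHom.mulRight (a (-i) k))).comp AddMonoidAlgebra.coeffAddEquiv.toAddMonoidHom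
  have hg : ∀ i x, g (AddMonoidAlgebra.single i x) = ∑ k, (x * a (-i) k) ⊗ₜ b (-i) k := by
    intro i x
    change (Finsupp.liftAddHom _) (Finsupp.single i x) = _
    rw [Finsupp.liftAddHom_apply_single, AddMonoidHom.finsetSum_apply]
    rfl
  have hb' : ∀ i k, b (-i) k ∈ c.piece i := fun i k => by simpa using hb (-i) k
  have hgf : Function.LeftInverse g f := by
    intro t
    induction t using TensorProduct.induction_on with
    | zero => simp
    | add s t hs ht => rw [map_add, map_add, hs, ht]
    | tmul y x =>
      induction x using c.induction_on with
      | add x x' hx hx' => rw [TensorProduct.tmul_add, map_add, map_add, hx, hx']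
      | homogeneous i x hx =>
        have hr : ∀ k, x * a (-i) k ∈ c.inv := fun k => mul_mem_inv hx (ha (-i) k)
        rw [hf i y x hx, hg]
        calc ∑ k, (y * x * a (-i) k) ⊗ₜ[c.inv] b (-i) k
            = ∑ k, y ⊗ₜ[c.inv] (x * (a (-i) k * b (-i) k)) := by
              refine Finset.sum_congr rfl fun k _ => ?_
              have h1 : y * x * a (-i) k = (⟨_, hr k⟩ : c.inv) • y := by
                change _ = x * a (-i) k * y
                ring
              rw [h1, TensorProduct.smul_tmul]
              congr 1
              change x * a (-i) k * b (-i) k = _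
              ring
          _ = y ⊗ₜ x := by
              rw [← TensorProduct.tmul_sum, ← Finset.mul_sum, hab, mul_one]
  have hfg : Function.RightInverse g f := by
    intro t
    induction t using AddMonoidAlgebra.induction_linear with
    | zero => simp
    | add s t hs ht => rw [map_add, map_add, hs, ht]
    | single i x =>
      rw [hg, map_sum]
      simp only [hf i _ _ (hb' i _)]
      calc ∑ k, AddMonoidAlgebra.single i (x * a (-i) k * b (-i) k)
          = AddMonoidAlgebra.singleAddHom i (∑ k, x * (a (-i) k * b (-i) k)) := by
            rw [map_sum]
            exact Finset.sum_congr rfl fun k _ => by rw [mul_assoc]; rfl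
        _ = AddMonoidAlgebra.single i x := by
            rw [← Finset.mul_sum, hab, mul_one]
            rfl
  have e : AddMonoidAlgebra A M ≃ₐ[A] A ⊗[c.inv] A :=
    (AlgEquiv.ofBijective f ⟨hgf.injective, hfg.surjective⟩).symm
  have := finitePresentation_addMonoidAlgebra A M
  have := Algebra.FinitePresentation.equiv e
  change (algebraMap c.inv A).FinitePresentation
  rw [RingHom.finitePresentation_algebraMap]
  exact .of_finitePresentation_tensorProduct_of_faithfullyFlat A

section Presentation

variable {R σ : Type*} [CommRing R] {d : (σ →₀ ℕ) →+ M}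

/-- The part of degree zero of a polynomial, for a grading of the monomials. -/
noncomputable def degreeZeroPart (R : Type*) [CommRing R] (d : (σ →₀ ℕ) →+ M) :
    MvPolynomial σ R →+ AddMonoidAlgebra R (AddMonoidHom.mker d) where
  toFun := AddMonoidAlgebra.comapDomain _ Subtype.val_injective
  map_zero' := by ext; simp
  map_add' x y := by ext; simp

lemma degreeZeroPart_single_mem {m : σ →₀ ℕ} (hm : d m = 0) (r : R) :
    degreeZeroPart R d (AddMonoidAlgebra.single m r) =
      AddMonoidAlgebra.single (⟨m, hm⟩ : AddMonoidHom.mker d) r := by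
  ext k
  change (Finsupp.single m r) k.1 = Finsupp.single (⟨m, hm⟩ : AddMonoidHom.mker d) r k
  classical
  rw [Finsupp.single_apply, Finsupp.single_apply]
  simp only [Subtype.ext_iff]

lemma degreeZeroPart_single_of_ne {m : σ →₀ ℕ} (hm : d m ≠ 0) (r : R) :
    degreeZeroPart R d (AddMonoidAlgebra.single m r) = 0 := by
  ext k
  change (Finsupp.single m r) k.1 = 0
  rw [Finsupp.single_eq_of_ne]
  rintro rfl
  exact hm k.2

lemma degreeZeroPart_single_mul {k : σ →₀ ℕ} (hk : d k = 0) (r : R) (y : MvPolynomial σ R) :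
    degreeZeroPart R d (AddMonoidAlgebra.single k r * y) =
      AddMonoidAlgebra.single (⟨k, hk⟩ : AddMonoidHom.mker d) r * degreeZeroPart R d y := by
  induction y using AddMonoidAlgebra.induction_linear with
  | zero => rw [mul_zero, map_zero, mul_zero]
  | add y z hy hz => rw [mul_add, map_add, hy, hz, map_add, mul_add]
  | single m s =>
    have hkm : d (k + m) = d m := by rw [map_add, hk, zero_add]
    rw [AddMonoidAlgebra.single_mul_single]
    by_cases hm : d m = 0
    · rw [degreeZeroPart_single_mem hm, degreeZeroPart_single_mem (hkm.trans hm),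
        AddMonoidAlgebra.single_mul_single]
      rfl
    · rw [degreeZeroPart_single_of_ne hm, mul_zero, degreeZeroPart_single_of_ne]
      rwa [hkm]

variable [Algebra R A] [Algebra R c.inv] [IsScalarTower R c.inv A] {φ : MvPolynomial σ R →ₐ[R] A}

lemma algebraMap_mem (r : R) : algebraMap R A r ∈ c.piece 0 := by
  rw [IsScalarTower.algebraMap_apply R c.inv A]
  exact (algebraMap R c.inv r).2

/-- The restriction to polynomials of degree zero of a graded homomorphism. -/
noncomputable def degreeZeroHom
    (hφ : ∀ m, φ (AddMonoidAlgebra.single m 1) ∈ c.piece (d m)) :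
    AddMonoidAlgebra R (AddMonoidHom.mker d) →ₐ[R] c.inv :=
  AddMonoidAlgebra.lift R _ _
    { toFun := fun k => ⟨φ (AddMonoidAlgebra.single k.toAdd.1 1), by
        have := hφ k.toAdd.1
        rwa [show d k.toAdd.1 = 0 from k.toAdd.2] at this⟩
      map_one' := Subtype.ext (map_one φ)
      map_mul' := fun k l => Subtype.ext (by
        change φ _ = φ _ * φ _
        rw [← map_mul, AddMonoidAlgebra.single_mul_single, mul_one]
        rfl) }

lemma degreeZeroHom_single (hφ : ∀ m, φ (AddMonoidAlgebra.single m 1) ∈ c.piece (d m))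
    (k : AddMonoidHom.mker d) (r : R) :
    (degreeZeroHom hφ (AddMonoidAlgebra.single k r) : A) = φ (AddMonoidAlgebra.single k.1 r) := by
  rw [degreeZeroHom, AddMonoidAlgebra.lift_single]
  have h : AddMonoidAlgebra.single k.1 r = r • AddMonoidAlgebra.single k.1 (1 : R) := by
    rw [AddMonoidAlgebra.smul_single, smul_eq_mul, mul_one]
  rw [h, map_smul, Algebra.smul_def, Algebra.smul_def, IsScalarTower.algebraMap_apply R c.inv A]
  rfl

lemma degreeZeroHom_degreeZeroPart (hφ : ∀ m, φ (AddMonoidAlgebra.single m 1) ∈ c.piece (d m))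
    (y : MvPolynomial σ R) : degreeZeroHom hφ (degreeZeroPart R d y) = c.projInv (φ y) := by
  induction y using AddMonoidAlgebra.induction_linear with
  | zero => simp
  | add y z hy hz => rw [map_add, map_add, hy, hz, map_add, map_add]
  | single m r =>
    have h1 : φ (AddMonoidAlgebra.single m r) ∈ c.piece (d m) := by
      have : AddMonoidAlgebra.single m r = algebraMap R (MvPolynomial σ R) r *
        AddMonoidAlgebra.single m 1 := by
        rw [← Algebra.smul_def, AddMonoidAlgebra.smul_single, smul_eq_mul, mul_one]
      rw [this, map_mul, AlgHom.commutes]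
      simpa using mul_mem (algebraMap_mem r) (hφ m)
    refine Subtype.ext ?_
    by_cases hm : d m = 0
    · rw [degreeZeroPart_single_mem hm, degreeZeroHom_single]
      rw [hm] at h1
      exact (proj_same h1).symm
    · rw [degreeZeroPart_single_of_ne hm, map_zero]
      exact (proj_of_ne (Ne.symm hm) h1).symm

lemma degreeZeroHom_surjective (hφ : ∀ m, φ (AddMonoidAlgebra.single m 1) ∈ c.piece (d m))
    (hs : Function.Surjective φ) : Function.Surjective (degreeZeroHom hφ) := by
  intro x
  obtain ⟨y, hy⟩ := hs x
  exact ⟨degreeZeroPart R d y, by rw [degreeZeroHom_degreeZeroPart, hy, projInv_apply_coe]⟩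

/-- The lift uses only monomials of degree zero, so that its full image under `φ`, and not just the
degree-zero component, is prescribed. This turns an element of the kernel of `degreeZeroHom` into
one of the kernel of `φ`. -/
lemma exists_degreeZeroPart_eq (hφ : ∀ m, φ (AddMonoidAlgebra.single m 1) ∈ c.piece (d m))
    (z : AddMonoidAlgebra R (AddMonoidHom.mker d)) :
    ∃ y, degreeZeroPart R d y = z ∧ φ y = degreeZeroHom hφ z := by
  induction z using AddMonoidAlgebra.induction_linear with
  | zero => exact ⟨0, by simp⟩
  | add z z' hz hz' =>
    obtain ⟨y, rfl, hy⟩ := hz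
    obtain ⟨y', rfl, hy'⟩ := hz'
    exact ⟨y + y', map_add _ _ _, by rw [map_add, hy, hy', map_add]; rfl⟩
  | single k r =>
    exact ⟨AddMonoidAlgebra.single k.1 r, degreeZeroPart_single_mem k.2 r,
      (degreeZeroHom_single hφ k r).symm⟩

/-- The monomials of degree zero form the locus where `d` agrees with `0`. Finiteness of `σ`
suffices; `M` may be arbitrary. -/
lemma fg_mker [Finite σ] (d : (σ →₀ ℕ) →+ M) : AddMonoid.FG (AddMonoidHom.mker d) :=
  (AddMonoid.fg_iff_addSubmonoid_fg _).mpr (AddSubmonoid.fg_eqLocusM d 0)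

/-- The generators are the degree-zero parts of `m₀ f`, where `f` runs over generators of `ker φ`,
not assumed homogeneous, and `m₀` over the minimal monomials of degree opposite to that of some
monomial of `f`. There are finitely many by Dickson's lemma. Any other monomial of such a degree is
`m₀ + k` with `k` of degree zero, and taking degree-zero parts is linear over such `k`. -/
lemma ker_degreeZeroHom_fg [Finite σ]
    (hφ : ∀ m, φ (AddMonoidAlgebra.single m 1) ∈ c.piece (d m))
    (hk : (RingHom.ker φ.toRingHom).FG) :
    (RingHom.ker (degreeZeroHom hφ).toRingHom).FG := by
  classical
  obtain ⟨s, hs⟩ := hk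
  let T : Set (MvPolynomial σ R × (σ →₀ ℕ)) := ⋃ f ∈ s, ⋃ m ∈ (AddMonoidAlgebra.coeff f).support,
    (fun m' => (f, m')) '' {m' | Minimal (fun m' => d m' = -d m) m'}
  have hT : T.Finite := s.finite_toSet.biUnion fun f _ =>
    (AddMonoidAlgebra.coeff f).support.finite_toSet.biUnion
    fun m _ => (finite_minimal_fiber d _).image _
  let w : MvPolynomial σ R × (σ →₀ ℕ) → AddMonoidAlgebra R (AddMonoidHom.mker d) :=
    fun x => degreeZeroPart R d (AddMonoidAlgebra.single x.2 1 * x.1)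
  refine Submodule.fg_def.mpr ⟨w '' T, hT.image w, le_antisymm (Ideal.span_le.mpr ?_) ?_⟩
  · rintro _ ⟨⟨f, m'⟩, hfm, rfl⟩
    simp only [T, Set.mem_iUnion] at hfm
    obtain ⟨f', hf', m, hm, m'', _, h⟩ := hfm
    obtain ⟨rfl, rfl⟩ := Prod.mk.inj h
    have hz : φ f' = 0 := by
      have : f' ∈ RingHom.ker φ.toRingHom := hs ▸ Ideal.subset_span hf'
      exact this
    change degreeZeroHom hφ (degreeZeroPart R d _) = 0
    rw [degreeZeroHom_degreeZeroPart]
    change c.projInv (φ (_ * f')) = 0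
    rw [map_mul, hz, mul_zero, map_zero]
  · have key : ∀ y ∈ Ideal.span (s : Set (MvPolynomial σ R)), ∀ z,
        degreeZeroPart R d (z * y) ∈ Ideal.span (w '' T) := by
      intro y hy
      induction hy using Submodule.span_induction with
      | zero => simp
      | add y y' _ _ hy hy' =>
        intro z
        rw [mul_add, map_add]
        exact add_mem (hy z) (hy' z)
      | smul r y _ hy =>
        intro z
        rw [smul_eq_mul, ← mul_assoc]
        exact hy _
      | mem f hf =>
        intro z
        induction z using AddMonoidAlgebra.induction_linear with
        | zero => simp
        | add z z' hz hz' =>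
          rw [add_mul, map_add]
          exact add_mem hz hz'
        | single m r =>
          by_cases h : ∃ m₁ ∈ (AddMonoidAlgebra.coeff f).support, d m = -d m₁
          · obtain ⟨m₁, hm₁, hd⟩ := h
            obtain ⟨m₀, hle, hmin⟩ :=
              exists_minimal_le_of_wellFoundedLT (fun m' => d m' = -d m₁) m hd
            obtain ⟨k, rfl⟩ := exists_add_of_le hle
            have hk : d k = 0 := by
              have := hmin.prop
              rw [map_add, this] at hd
              simpa using hd
            have h1 : AddMonoidAlgebra.single (m₀ + k) r * f =
                AddMonoidAlgebra.single k r * (AddMonoidAlgebra.single m₀ 1 * f) := by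
              rw [← mul_assoc, AddMonoidAlgebra.single_mul_single, mul_one, add_comm]
            rw [h1, degreeZeroPart_single_mul hk]
            refine Ideal.mul_mem_left _ _ (Ideal.subset_span ⟨(f, m₀), ?_, rfl⟩)
            simp only [T, Set.mem_iUnion]
            exact ⟨f, hf, m₁, hm₁, m₀, hmin, rfl⟩
          · push Not at h
            -- No monomial of `f` has degree opposite to that of `m`, so the product has no
            -- degree-zero part.
            convert Ideal.zero_mem _
            rw [← AddMonoidAlgebra.sum_coeff_single f, Finsupp.sum, Finset.mul_sum, map_sum]
            refine Finset.sum_eq_zero fun m₁ hm₁ => ?_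
            rw [AddMonoidAlgebra.single_mul_single, degreeZeroPart_single_of_ne]
            rw [map_add]
            exact fun h0 => h m₁ hm₁ (eq_neg_of_add_eq_zero_left h0)
    intro z hz
    obtain ⟨y, rfl, hy⟩ := exists_degreeZeroPart_eq hφ z
    have h0 : degreeZeroHom hφ (degreeZeroPart R d y) = 0 := hz
    have h1 : y ∈ Ideal.span (s : Set (MvPolynomial σ R)) := by
      rw [hs]
      change φ y = 0
      rw [hy, h0]
      rfl
    simpa using key y h1 1

end Presentation

/-- An algebra of finite type with a coaction is generated by finitely many homogeneous elements. -/
lemma exists_graded_presentation {R : Type*} [CommRing R] [Algebra R A] [Algebra.FiniteType R A]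
    (c : GroupAlgebraCoaction A M) :
    ∃ (t : Finset (M × A)) (d : (t →₀ ℕ) →+ M) (φ : MvPolynomial t R →ₐ[R] A),
      (∀ m, φ (AddMonoidAlgebra.single m 1) ∈ c.piece (d m)) ∧ Function.Surjective φ := by
  classical
  obtain ⟨s, hs⟩ := (inferInstance : Algebra.FiniteType R A)
  -- The variables are pairs (degree, component), so that each carries its own degree even if the
  -- same element of `A` occurs in several degrees.
  let t : Finset (M × A) := s.biUnion fun f =>
    (c.hom f).coeff.support.image fun i => (i, c.proj i f)
  have ht : ∀ x ∈ t, x.2 ∈ c.piece x.1 := by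
    intro x hx
    simp only [t, Finset.mem_biUnion, Finset.mem_image] at hx
    obtain ⟨f, _, i, _, rfl⟩ := hx
    exact proj_mem i f
  let d : (t →₀ ℕ) →+ M := Finsupp.liftAddHom fun x => multiplesHom M x.1.1
  let φ : MvPolynomial t R →ₐ[R] A := MvPolynomial.aeval fun x : t => x.1.2
  refine ⟨t, d, φ, fun m => ?_, ?_⟩
  · induction m using Finsupp.induction_linear with
    | zero =>
      rw [map_zero, show (AddMonoidAlgebra.single 0 1 : MvPolynomial t R) = 1 from rfl, map_one]
      exact one_mem
    | add m m' hm hm' =>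
      have : (AddMonoidAlgebra.single (m + m') 1 : MvPolynomial t R) =
          AddMonoidAlgebra.single m 1 * AddMonoidAlgebra.single m' 1 := by
        rw [AddMonoidAlgebra.single_mul_single, mul_one]
      rw [this, map_mul, map_add]
      exact mul_mem hm hm'
    | single x n =>
      have h1 : φ (AddMonoidAlgebra.single (Finsupp.single x n) 1) = x.1.2 ^ n := by
        change MvPolynomial.aeval _ (MvPolynomial.monomial (Finsupp.single x n) 1) = _
        rw [MvPolynomial.aeval_monomial, map_one, one_mul]
        exact Finsupp.prod_single_index (pow_zero _)
      have h2 : d (Finsupp.single x n) = n • x.1.1 := by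
        simp [d]
      rw [h1, h2]
      clear h1 h2
      induction n with
      | zero => rw [pow_zero, zero_smul]; exact one_mem
      | succ n ih => rw [pow_succ, succ_nsmul]; exact mul_mem ih (ht _ x.2)
  · rw [← AlgHom.range_eq_top, eq_top_iff, ← hs, Algebra.adjoin_le_iff]
    intro f hf
    rw [← c.sum_proj f]
    refine sum_mem fun i hi => ?_
    have hx : (i, c.proj i f) ∈ t := by
      simp only [t, Finset.mem_biUnion, Finset.mem_image]
      exact ⟨f, hf, i, hi, rfl⟩
    exact ⟨MvPolynomial.X ⟨_, hx⟩, MvPolynomial.aeval_X _ _⟩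

/-- A graded surjection from a polynomial ring restricts to a surjection onto `A_0` from the algebra
of the monoid of degree-zero monomials, which is finitely generated. -/
lemma finiteType_inv {R : Type*} [CommRing R] (ψ : R →+* c.inv)
    (h : (c.inv.subtype.comp ψ).FiniteType) : ψ.FiniteType := by
  algebraize [ψ, c.inv.subtype.comp ψ]
  have : IsScalarTower R c.inv A := .of_algebraMap_eq' rfl
  have : Algebra.FiniteType R A := h
  obtain ⟨t, d, φ, hφ, hs⟩ := c.exists_graded_presentation (R := R)
  have := fg_mker d
  have h1 : Algebra.FiniteType R (AddMonoidAlgebra R (AddMonoidHom.mker d)) :=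
    AddMonoidAlgebra.finiteType_of_fg R _
  exact Algebra.FiniteType.of_surjective (degreeZeroHom hφ) (degreeZeroHom_surjective hφ hs)

lemma finitePresentation_inv {R : Type*} [CommRing R] (ψ : R →+* c.inv)
    (h : (c.inv.subtype.comp ψ).FinitePresentation) : ψ.FinitePresentation := by
  algebraize [ψ, c.inv.subtype.comp ψ]
  have : IsScalarTower R c.inv A := .of_algebraMap_eq' rfl
  have : Algebra.FinitePresentation R A := h
  obtain ⟨t, d, φ, hφ, hs⟩ := c.exists_graded_presentation (R := R)
  have := fg_mker d
  have h1 := finitePresentation_addMonoidAlgebra R (AddMonoidHom.mker d)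
  exact Algebra.FinitePresentation.of_surjective (degreeZeroHom_surjective hφ hs)
    (ker_degreeZeroHom_fg hφ (Algebra.FinitePresentation.ker_fG_of_surjective φ hs))

end GroupAlgebraCoaction

end

/-! ### Morphisms to schemes affine over the base, in terms of sections. -/

section

open Limits

section Scheme

variable {X Y : Scheme.{u}}

lemma toSpecΓ_SpecMap_injective {V : X.Opens} {A : CommRingCat.{u}} {φ ψ : A ⟶ Γ(X, V)}
    (h : V.toSpecΓ ≫ Spec.map φ = V.toSpecΓ ≫ Spec.map ψ) : φ = ψ := by
  have h1 := congrArg Scheme.Hom.appTop h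
  rw [Scheme.Hom.comp_appTop, Scheme.Hom.comp_appTop, Scheme.Opens.toSpecΓ_appTop,
    ← Category.assoc, ← Category.assoc, cancel_mono] at h1
  have h2 := congrArg (fun f => (Scheme.ΓSpecIso A).inv ≫ f) h1
  simpa using h2

lemma ι_comp_eq_toSpecΓ (f : X ⟶ Y) {W : Y.Opens} (hW : IsAffineOpen W) (V : X.Opens)
    (e : V ≤ f ⁻¹ᵁ W) :
    V.ι ≫ f = V.toSpecΓ ≫ Spec.map (f.appLE W V e) ≫ hW.fromSpec := by
  rw [Scheme.Opens.toSpecΓ_SpecMap_appLE_assoc, hW.toSpecΓ_fromSpec, Scheme.Hom.resLE_comp_ι]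

end Scheme

variable {S : Scheme.{u}} {T T' P : Over S}

lemma preimage_le_preimage (p : T ⟶ P) (U : S.Opens) :
    T.hom ⁻¹ᵁ U ≤ p.left ⁻¹ᵁ (P.hom ⁻¹ᵁ U) := by
  rw [← Scheme.Hom.comp_preimage, Over.w p]

/-- Pullback of sections along a morphism of `S`-schemes, as a ring homomorphism. -/
noncomputable def pullHom (p : T ⟶ P) (U : S.Opens) :
    Γ(P.left, P.hom ⁻¹ᵁ U) ⟶ Γ(T.left, T.hom ⁻¹ᵁ U) :=
  p.left.appLE (P.hom ⁻¹ᵁ U) (T.hom ⁻¹ᵁ U) (preimage_le_preimage p U)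

/-- Restriction of sections of the direct image on `S` of a structure sheaf. -/
noncomputable def resHom (T : Over S) {U V : S.Opens} (h : V ≤ U) :
    Γ(T.left, T.hom ⁻¹ᵁ U) ⟶ Γ(T.left, T.hom ⁻¹ᵁ V) :=
  T.left.presheaf.map (homOfLE (T.hom.preimage_mono h)).op

lemma resHom_comp (T : Over S) {U V W : S.Opens} (h : V ≤ U) (h' : W ≤ V) :
    resHom T h ≫ resHom T h' = resHom T (h'.trans h) := by
  rw [resHom, resHom, ← Functor.map_comp]
  rfl

lemma resHom_self (T : Over S) (U : S.Opens) : resHom T (le_refl U) = 𝟙 _ :=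
  T.left.presheaf.map_id _

lemma pullHom_comp (f : T' ⟶ T) (p : T ⟶ P) (U : S.Opens) :
    pullHom (f ≫ p) U = pullHom p U ≫ pullHom f U :=
  (Scheme.Hom.appLE_comp_appLE _ _ _ _ _ _ _).symm

lemma resHom_pullHom (p : T ⟶ P) {U V : S.Opens} (h : V ≤ U) :
    resHom P h ≫ pullHom p V = pullHom p U ≫ resHom T h :=
  (Scheme.Hom.map_appLE _ _ _).trans (Scheme.Hom.appLE_map _ _ _).symm

lemma app_pullHom (p : T ⟶ P) (U : S.Opens) : P.hom.app U ≫ pullHom p U = T.hom.app U := by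
  rw [Scheme.Hom.app_eq_appLE, pullHom, Scheme.Hom.appLE_comp_appLE, Scheme.Hom.app_eq_appLE]
  simp only [Over.w]

lemma app_resHom (T : Over S) {U V : S.Opens} (h : V ≤ U) :
    T.hom.app U ≫ resHom T h = S.presheaf.map (homOfLE h).op ≫ T.hom.app V :=
  (T.hom.naturality (homOfLE h).op).symm

lemma ι_comp_eq_of_pullHom_eq {f g : T ⟶ P} {U : S.Opens}
    (hPU : IsAffineOpen (P.hom ⁻¹ᵁ U)) (h : pullHom f U = pullHom g U) :
    (T.hom ⁻¹ᵁ U).ι ≫ f.left = (T.hom ⁻¹ᵁ U).ι ≫ g.left := by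
  rw [ι_comp_eq_toSpecΓ f.left hPU _ (preimage_le_preimage f U),
    ι_comp_eq_toSpecΓ g.left hPU _ (preimage_le_preimage g U)]
  exact congrArg (fun k => _ ≫ Spec.map k ≫ _) h

lemma isOpenCover_preimage (T : Over S) :
    TopologicalSpace.IsOpenCover (fun U : S.affineOpens => T.hom ⁻¹ᵁ U.1) :=
  .comap (iSup_affineOpens_eq_top S) T.hom.base.1

/-- Morphisms to a scheme affine over `S` are determined by the pullback of sections. -/
lemma hom_ext_of_pullHom_eq [IsAffineHom P.hom] {f g : T ⟶ P}
    (h : ∀ U : S.affineOpens, pullHom f U.1 = pullHom g U.1) : f = g := by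
  refine Over.OverMorphism.ext (Scheme.Cover.hom_ext
    (T.left.openCoverOfIsOpenCover _ (isOpenCover_preimage T)) _ _ fun U => ?_)
  exact ι_comp_eq_of_pullHom_eq (U.2.preimage P.hom) (h U)

lemma hom_ext_of_preimage_eq_top {f g : T ⟶ P} {U : S.Opens}
    (hPU : IsAffineOpen (P.hom ⁻¹ᵁ U)) (hT : T.hom ⁻¹ᵁ U = ⊤)
    (h : pullHom f U = pullHom g U) : f = g := by
  have h1 := ι_comp_eq_of_pullHom_eq hPU h
  have : IsIso (T.hom ⁻¹ᵁ U).ι := by rw [hT]; exact (Scheme.topIso T.left).isIso_hom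
  exact Over.OverMorphism.ext ((cancel_epi _).mp h1)

/-- Morphisms to a scheme affine over `S` are given by homomorphisms of algebras, over an affine
open subset of `S`. -/
lemma exists_pullHom_eq {U : S.Opens} (hU : IsAffineOpen U)
    (hPU : IsAffineOpen (P.hom ⁻¹ᵁ U)) (hT : T.hom ⁻¹ᵁ U = ⊤)
    (φ : Γ(P.left, P.hom ⁻¹ᵁ U) ⟶ Γ(T.left, T.hom ⁻¹ᵁ U))
    (hφ : P.hom.app U ≫ φ = T.hom.app U) : ∃ f : T ⟶ P, pullHom f U = φ := by
  have hV : IsIso (T.hom ⁻¹ᵁ U).ι := by rw [hT]; exact (Scheme.topIso T.left).isIso_hom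
  let f : T.left ⟶ P.left :=
    inv (T.hom ⁻¹ᵁ U).ι ≫ (T.hom ⁻¹ᵁ U).toSpecΓ ≫ Spec.map φ ≫ hPU.fromSpec
  have hf : f ≫ P.hom = T.hom := by
    rw [← cancel_epi (T.hom ⁻¹ᵁ U).ι, ι_comp_eq_toSpecΓ T.hom hU _ le_rfl,
      Scheme.Hom.appLE_eq_app, ← hφ, Spec.map_comp]
    simp only [f, Category.assoc, IsIso.hom_inv_id_assoc]
    rw [← IsAffineOpen.SpecMap_appLE_fromSpec P.hom hU hPU le_rfl, Scheme.Hom.appLE_eq_app]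
  refine ⟨Over.homMk f hf, toSpecΓ_SpecMap_injective ?_⟩
  rw [← cancel_mono hPU.fromSpec, Category.assoc, Category.assoc]
  refine (ι_comp_eq_toSpecΓ f hPU _ _).symm.trans ?_
  simp only [f, IsIso.hom_inv_id_assoc]

lemma isIso_pullHom (j : T' ⟶ T) [IsOpenImmersion j.left] {U : S.Opens}
    (h : T.hom ⁻¹ᵁ U ≤ j.left.opensRange) : IsIso (pullHom j U) := by
  have h1 : j.left ⁻¹ᵁ T.hom ⁻¹ᵁ U = T'.hom ⁻¹ᵁ U := by
    rw [← Scheme.Hom.comp_preimage, Over.w j]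
  have := Scheme.Hom.isIso_app j.left _ h
  have : IsIso (T'.left.presheaf.map (homOfLE h1.ge).op) := by
    rw [show (homOfLE h1.ge).op = eqToHom (congrArg op h1) from rfl]
    infer_instance
  rw [pullHom, Scheme.Hom.appLE]
  infer_instance

lemma isIso_resHom {U V : S.Opens} (h : V ≤ U) (hT : T.hom ⁻¹ᵁ U ≤ T.hom ⁻¹ᵁ V) :
    IsIso (resHom T h) := by
  have h1 : T.hom ⁻¹ᵁ U = T.hom ⁻¹ᵁ V := le_antisymm hT (T.hom.preimage_mono h)
  rw [resHom, show (homOfLE (T.hom.preimage_mono h)).op = eqToHom (congrArg op h1) from rfl]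
  infer_instance

/-- The open cover of an `S`-scheme by the inverse images of the affine open subsets of `S`. -/
noncomputable abbrev affineBaseCover (T : Over S) : T.left.OpenCover :=
  (Scheme.AffineZariskiSite.directedCover S).pullback₁ T.hom

/-- Morphisms to a scheme affine over `S` are given by compatible homomorphisms of algebras. -/
lemma exists_forall_pullHom_eq [IsAffineHom P.hom]
    (φ : ∀ U : S.affineOpens, (Γ(P.left, P.hom ⁻¹ᵁ U.1) ⟶ Γ(T.left, T.hom ⁻¹ᵁ U.1)))
    (hφ : ∀ U, P.hom.app U.1 ≫ φ U = T.hom.app U.1)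
    (hres : ∀ (U V : S.affineOpens) (h : V.1 ≤ U.1), (∃ r : Γ(S, U.1), S.basicOpen r = V.1) →
      resHom P h ≫ φ V = φ U ≫ resHom T h) :
    ∃ f : T ⟶ P, ∀ U : S.affineOpens, pullHom f U.1 = φ U := by
  -- These are the members of `affineBaseCover T`. In its index category `V ≤ U` means that `V` is a
  -- basic open subset of `U`, so compatibility for such pairs is enough to glue.
  let TU : S.affineOpens → Over S := fun U => Over.mk (pullback.fst T.hom U.1.ι ≫ T.hom)
  let j : ∀ U, TU U ⟶ T := fun U => Over.homMk (pullback.fst T.hom U.1.ι)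
  have hTU : ∀ (U V : S.affineOpens), U.1 ≤ V.1 → (TU U).hom ⁻¹ᵁ V.1 = ⊤ := by
    intro U V hUV
    rw [eq_top_iff]
    intro x _
    change (pullback.fst T.hom U.1.ι ≫ T.hom) x ∈ V.1
    rw [pullback.condition]
    exact hUV (pullback.snd T.hom U.1.ι x).2
  have ex : ∀ U : S.affineOpens, ∃ f : TU U ⟶ P, pullHom f U.1 = φ U ≫ pullHom (j U) U.1 := by
    intro U
    refine exists_pullHom_eq U.2 (U.2.preimage P.hom) (hTU U U le_rfl) _ ?_
    rw [← Category.assoc, hφ, app_pullHom]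
  choose f hf using ex
  have compat : ∀ (V U : S.affineOpens) (_ : V.1 ≤ U.1)
      (_ : ∃ r : Γ(S, U.1), S.basicOpen r = V.1) (k : TU V ⟶ TU U), k ≫ j U = j V →
      k ≫ f U = f V := by
    intro V U h hr k hk
    refine hom_ext_of_preimage_eq_top (U.2.preimage P.hom) (hTU V U h) ?_
    -- All of `TU V` lies over `V`, so sections over `U` may be compared after restriction to `V`.
    have hiso : IsIso (resHom (TU V) h) :=
      isIso_resHom h (by rw [hTU V U h, hTU V V le_rfl])
    rw [← cancel_mono (resHom (TU V) h), pullHom_comp, hf, Category.assoc, Category.assoc,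
      ← Category.assoc (pullHom (j U) U.1), ← pullHom_comp, hk, ← resHom_pullHom, ← resHom_pullHom,
      hf, ← Category.assoc, ← Category.assoc, hres U V h hr]
  let F : T ⟶ P := Scheme.OpenCover.glueMorphismsOverOfLocallyDirected (affineBaseCover T)
    (fun U => (f U).left) (by
    intro V U hVU
    have hle : (show S.AffineZariskiSite from V) ≤ (show S.AffineZariskiSite from U) :=
      leOfHom (X := S.AffineZariskiSite) hVU
    have hk : Scheme.Cover.trans (affineBaseCover T) hVU ≫ pullback.fst T.hom U.1.ι =
        pullback.fst T.hom V.1.ι :=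
      Scheme.Cover.trans_map (affineBaseCover T) hVU
    let k : TU V ⟶ TU U := Over.homMk (Scheme.Cover.trans (affineBaseCover T) hVU)
      ((Category.assoc _ _ _).symm.trans (congrArg (fun x => x ≫ T.hom) hk))
    exact congrArg (fun f => Over.Hom.left f) (compat V U
      (Scheme.AffineZariskiSite.toOpens_mono hle) hle k (by ext1; exact hk)))
    (fun U => Over.w (f U))
  have hF : ∀ U : S.affineOpens, j U ≫ F = f U := by
    intro U
    ext1
    exact Scheme.OpenCover.map_glueMorphismsOverOfLocallyDirected_left (affineBaseCover T) _ _ _ U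
  refine ⟨F, fun U => ?_⟩
  have : IsOpenImmersion (j U).left := inferInstanceAs (IsOpenImmersion (pullback.fst T.hom U.1.ι))
  have hiso : IsIso (pullHom (j U) U.1) := by
    refine isIso_pullHom _ ?_
    intro x hx
    change x ∈ Set.range (pullback.fst T.hom U.1.ι)
    rw [Scheme.Pullback.range_fst, Scheme.Opens.range_ι]
    exact hx
  rw [← cancel_mono (pullHom (j U) U.1), ← pullHom_comp, hF, hf]

end

/-! ### Ring-valued points and characters over an affine open subset. -/

section

section EvalAt

variable {A B C M : Type*} [CommRing A] [CommRing B] [CommRing C] [AddCommGroup M]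

/-- The homomorphism from a group algebra given by a homomorphism of rings and a character. -/
noncomputable def evalAt (φ : A →+* B) (γ : Multiplicative M →* B) : AddMonoidAlgebra A M →+* B :=
  AddMonoidAlgebra.liftNCRingHom φ γ fun _ _ => Commute.all _ _

lemma evalAt_single (φ : A →+* B) (γ : Multiplicative M →* B) (i : M) (a : A) :
    evalAt φ γ (AddMonoidAlgebra.single i a) = φ a * γ (Multiplicative.ofAdd i) :=
  AddMonoidAlgebra.liftNC_single _ _ _ _

lemma evalAt_apply (φ : A →+* B) (γ : Multiplicative M →* B) (x : AddMonoidAlgebra A M) :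
    evalAt φ γ x = x.coeff.sum fun i a => φ a * γ (Multiplicative.ofAdd i) := by
  conv_lhs => rw [← AddMonoidAlgebra.sum_coeff_single x]
  rw [Finsupp.sum, map_sum]
  exact Finset.sum_congr rfl fun i _ => evalAt_single _ _ _ _

lemma comp_evalAt (f : B →+* C) (φ : A →+* B) (γ : Multiplicative M →* B) :
    f.comp (evalAt φ γ) = evalAt (f.comp φ) ((f : B →* C).comp γ) := by
  refine AddMonoidAlgebra.ringHom_ext (fun r => ?_) fun i => ?_ <;>
  simp only [RingHom.comp_apply, evalAt_single, map_mul] <;> rfl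

end EvalAt

variable {S : Scheme.{u}} {T T' P : Over S} {M : Type u} [AddCommGroup M]

section SpecOver

variable {U : S.Opens} (hU : IsAffineOpen U) {A B : CommRingCat.{u}} (ψ : Γ(S, U) ⟶ B)

/-- The spectrum of an algebra over the sections of an affine open subset of `S`. -/
noncomputable abbrev specOver : Over S := Over.mk (Spec.map ψ ≫ hU.fromSpec)

lemma specOver_preimage : (specOver hU ψ).hom ⁻¹ᵁ U = ⊤ := by
  change (Spec.map ψ ≫ hU.fromSpec) ⁻¹ᵁ U = ⊤
  rw [Scheme.Hom.comp_preimage, hU.fromSpec_preimage_self]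
  rfl

/-- The sections of the spectrum of an algebra. -/
noncomputable def specEval : Γ((specOver hU ψ).left, (specOver hU ψ).hom ⁻¹ᵁ U) ⟶ B :=
  (Spec B).presheaf.map (homOfLE (specOver_preimage hU ψ).ge).op ≫ (Scheme.ΓSpecIso B).hom

instance : IsIso (specEval hU ψ) := by
  have : IsIso ((Spec B).presheaf.map (homOfLE (specOver_preimage hU ψ).ge).op) := by
    rw [show (homOfLE (specOver_preimage hU ψ).ge).op =
      eqToHom (congrArg op (specOver_preimage hU ψ)) from rfl]
    infer_instance
  rw [specEval]
  infer_instance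

lemma fromSpec_appLE_top :
    hU.fromSpec.appLE U ⊤ hU.fromSpec_preimage_self.ge = (Scheme.ΓSpecIso Γ(S, U)).inv := by
  rw [Scheme.Hom.appLE, hU.fromSpec_app_self, Category.assoc, ← Functor.map_comp]
  exact (congrArg (fun k => _ ≫ k) ((Spec Γ(S, U)).presheaf.map_id (op ⊤))).trans
    (Category.comp_id _)

lemma app_specEval : (specOver hU ψ).hom.app U ≫ specEval hU ψ = ψ := by
  have h1 : (Spec.map ψ ≫ hU.fromSpec).appLE U ⊤ (specOver_preimage hU ψ).ge =
      (Scheme.ΓSpecIso Γ(S, U)).inv ≫ (Spec.map ψ).appTop := by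
    rw [← fromSpec_appLE_top, Scheme.Hom.appTop, Scheme.Hom.app_eq_appLE]
    exact (Scheme.Hom.appLE_comp_appLE _ _ _ _ _ hU.fromSpec_preimage_self.ge le_rfl).symm
  have h2 : (specOver hU ψ).hom.app U ≫
      (Spec B).presheaf.map (homOfLE (specOver_preimage hU ψ).ge).op =
      (Spec.map ψ ≫ hU.fromSpec).appLE U ⊤ (specOver_preimage hU ψ).ge := rfl
  rw [specEval, ← Category.assoc, h2, h1, Category.assoc, Scheme.ΓSpecIso_naturality,
    Iso.inv_hom_id_assoc]

/-- The restriction of global sections to the inverse image of an open subset of `S`. -/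
noncomputable def topRes (T : Over S) (U : S.Opens) : Γ(T.left, ⊤) ⟶ Γ(T.left, T.hom ⁻¹ᵁ U) :=
  T.left.presheaf.map (homOfLE le_top).op

lemma topRes_specEval : topRes (specOver hU ψ) U ≫ specEval hU ψ = (Scheme.ΓSpecIso B).hom := by
  have h : topRes (specOver hU ψ) U ≫
      (Spec B).presheaf.map (homOfLE (specOver_preimage hU ψ).ge).op = 𝟙 _ :=
    ((Spec B).presheaf.map_comp _ _).symm.trans ((Spec B).presheaf.map_id (op ⊤))
  rw [specEval, ← Category.assoc, h]
  exact Category.id_comp _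

/-- The character with values in the units of an affine scheme given by a character with values
in a ring. -/
noncomputable def specChar (γ : Multiplicative M →* Bˣ) :
    Multiplicative M →* Γ((specOver hU ψ).left, ⊤)ˣ :=
  (Units.map ((Scheme.ΓSpecIso B).inv.hom : B →* Γ(Spec B, ⊤))).comp γ

lemma exists_specPoint (hPU : IsAffineOpen (P.hom ⁻¹ᵁ U)) (φ : Γ(P.left, P.hom ⁻¹ᵁ U) ⟶ B) :
    ∃ p : specOver hU (P.hom.app U ≫ φ) ⟶ P, pullHom p U ≫ specEval hU _ = φ := by
  obtain ⟨p, hp⟩ := exists_pullHom_eq hU hPU (specOver_preimage hU (P.hom.app U ≫ φ))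
    (φ ≫ inv (specEval hU (P.hom.app U ≫ φ)))
    (by rw [← Category.assoc, IsIso.comp_inv_eq, app_specEval])
  exact ⟨p, by rw [hp, Category.assoc, IsIso.inv_hom_id, Category.comp_id]⟩

/-- The point of an affine scheme with values in a ring given by a homomorphism. -/
noncomputable def specPoint (hPU : IsAffineOpen (P.hom ⁻¹ᵁ U)) (φ : Γ(P.left, P.hom ⁻¹ᵁ U) ⟶ B) :
    specOver hU (P.hom.app U ≫ φ) ⟶ P :=
  (exists_specPoint hU hPU φ).choose

lemma pullHom_specPoint (hPU : IsAffineOpen (P.hom ⁻¹ᵁ U)) (φ : Γ(P.left, P.hom ⁻¹ᵁ U) ⟶ B) :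
    pullHom (specPoint hU hPU φ) U ≫ specEval hU _ = φ :=
  (exists_specPoint hU hPU φ).choose_spec

end SpecOver

/-- The restriction of a character to the inverse image of an open subset of `S`. -/
noncomputable def charHom (g : Multiplicative M →* Γ(T.left, ⊤)ˣ) (U : S.Opens) :
    Multiplicative M →* Γ(T.left, T.hom ⁻¹ᵁ U) :=
  (topRes T U).hom.toMonoidHom.comp ((Units.coeHom _).comp g)

lemma charHom_apply (g : Multiplicative M →* Γ(T.left, ⊤)ˣ) (U : S.Opens) (m : Multiplicative M) :
    charHom g U m = (topRes T U).hom (g m) := rfl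

lemma specEval_charHom {U : S.Opens} (hU : IsAffineOpen U) {B : CommRingCat.{u}} (ψ : Γ(S, U) ⟶ B)
    (γ : Multiplicative M →* Bˣ) :
    (specEval hU ψ).hom.toMonoidHom.comp (charHom (specChar hU ψ γ) U) = (Units.coeHom B).comp γ :=
  MonoidHom.ext fun m => by
    have h : (Scheme.ΓSpecIso B).inv ≫ topRes (specOver hU ψ) U ≫ specEval hU ψ = 𝟙 B := by
      rw [topRes_specEval, Iso.inv_hom_id]
    exact congrArg (fun k => k.hom (γ m : B)) h

/-- The pullback of a character. -/
noncomputable abbrev pullChar (f : T' ⟶ T) (g : Multiplicative M →* Γ(T.left, ⊤)ˣ) :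
    Multiplicative M →* Γ(T'.left, ⊤)ˣ :=
  ((diagonalizableGroup S M).map f.op).hom g

lemma topRes_pullHom (f : T' ⟶ T) (U : S.Opens) :
    topRes T U ≫ pullHom f U = f.left.appTop ≫ topRes T' U :=
  (Scheme.Hom.map_appLE _ _ _).trans rfl

lemma pullHom_charHom (f : T' ⟶ T) (g : Multiplicative M →* Γ(T.left, ⊤)ˣ) (U : S.Opens) :
    (pullHom f U).hom.toMonoidHom.comp (charHom g U) = charHom (pullChar f g) U :=
  MonoidHom.ext fun m => congrArg (fun k => k.hom (g m : Γ(T.left, ⊤))) (topRes_pullHom f U)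

lemma isIso_topRes {U : S.Opens} (hT : T.hom ⁻¹ᵁ U = ⊤) : IsIso (topRes T U) := by
  rw [topRes, show (homOfLE (le_top : T.hom ⁻¹ᵁ U ≤ ⊤)).op =
    eqToHom (congrArg op hT.symm) from rfl]
  infer_instance

lemma charHom_injective {U : S.Opens} (hT : T.hom ⁻¹ᵁ U = ⊤)
    {g g' : Multiplicative M →* Γ(T.left, ⊤)ˣ} (h : charHom g U = charHom g' U) : g = g' := by
  have := isIso_topRes hT
  refine MonoidHom.ext fun m => Units.ext ?_
  exact (ConcreteCategory.bijective_of_isIso (topRes T U)).1 (DFunLike.congr_fun h m)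

end

/-! ### The coaction attached to an action. -/

section

section Coassoc

variable {A M : Type u} [CommRing A] [AddCommGroup M]

/-- A homomorphism `A → A[M]` whose values at points satisfy the associativity of an action is
coassociative. -/
lemma hom_coeff_of_evalAt_evalAt (δ : A →+* AddMonoidAlgebra A M)
    (h : ∀ (B : Type u) [CommRing B] (φ : A →+* B) (γ₁ γ₂ : Multiplicative M →* Bˣ) (a : A),
      evalAt ((evalAt φ ((Units.coeHom B).comp γ₁)).comp δ) ((Units.coeHom B).comp γ₂) (δ a) =
        (δ a).coeff.sum fun j b =>
          φ b * ((γ₁ (Multiplicative.ofAdd j) : B) * γ₂ (Multiplicative.ofAdd j))) (a : A) (i : M) :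
    δ ((δ a).coeff i) = AddMonoidAlgebra.single i ((δ a).coeff i) := by
  -- The universal case: over `A[M][M]`, take for `γ₁` and `γ₂` the tautological characters of the
  -- inner and outer variables. The coefficient of degree `i` in the outer variable is then `δ` of
  -- the coefficient `a_i` of `δ a` on one side, and `a_i` placed in degree `i` on the other.
  let ι₁ : AddMonoidAlgebra A M →+* AddMonoidAlgebra (AddMonoidAlgebra A M) M :=
    AddMonoidAlgebra.singleZeroRingHom
  let φ : A →+* AddMonoidAlgebra (AddMonoidAlgebra A M) M :=
    ι₁.comp AddMonoidAlgebra.singleZeroRingHom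
  let γ₁ : Multiplicative M →* (AddMonoidAlgebra (AddMonoidAlgebra A M) M)ˣ :=
    (Units.map (ι₁ : AddMonoidAlgebra A M →* _)).comp (AddMonoidAlgebra.of A M).toHomUnits
  let γ₂ : Multiplicative M →* (AddMonoidAlgebra (AddMonoidAlgebra A M) M)ˣ :=
    (AddMonoidAlgebra.of (AddMonoidAlgebra A M) M).toHomUnits
  have h1 := h _ φ γ₁ γ₂ a
  have h2 : evalAt φ ((Units.coeHom _).comp γ₁) = ι₁ := by
    refine AddMonoidAlgebra.ringHom_ext (fun r => ?_) fun i => ?_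
    · rw [evalAt_single, ofAdd_zero, map_one, mul_one]
      rfl
    · rw [evalAt_single, map_one, one_mul]
      rfl
  have h4 (x : AddMonoidAlgebra A M) (j : M) :
      (evalAt (ι₁.comp δ) ((Units.coeHom _).comp γ₂) x).coeff j = δ (x.coeff j) := by
    induction x using AddMonoidAlgebra.induction_linear with
    | zero => simp
    | add x y hx hy => rw [map_add, AddMonoidAlgebra.coeff_add, Finsupp.add_apply, hx, hy,
        AddMonoidAlgebra.coeff_add, Finsupp.add_apply, map_add]
    | single k x =>
      rw [evalAt_single]
      change (AddMonoidAlgebra.single 0 (δ x) * AddMonoidAlgebra.single k 1).coeff j = _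
      rw [AddMonoidAlgebra.single_mul_single, zero_add, mul_one]
      by_cases hk : k = j
      · subst hk; simp
      · simp [hk]
  classical
  have h5 (j k : M) (x : A) : (φ x * ((γ₁ (Multiplicative.ofAdd k)).1 *
      (γ₂ (Multiplicative.ofAdd k)).1)).coeff j =
        if k = j then AddMonoidAlgebra.single j x else 0 := by
    have : φ x * ((γ₁ (Multiplicative.ofAdd k)).1 * (γ₂ (Multiplicative.ofAdd k)).1) =
        AddMonoidAlgebra.single k (AddMonoidAlgebra.single k x) := by
      change AddMonoidAlgebra.single 0 (AddMonoidAlgebra.single 0 x) *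
        (AddMonoidAlgebra.single 0 (AddMonoidAlgebra.single k 1) *
          AddMonoidAlgebra.single k 1) = _
      rw [AddMonoidAlgebra.single_mul_single, AddMonoidAlgebra.single_mul_single,
        mul_one, AddMonoidAlgebra.single_mul_single, zero_add, zero_add, mul_one]
    rw [this, AddMonoidAlgebra.coeff_single, Finsupp.single_apply]
    split_ifs with hk
    · rw [hk]
    · rfl
  rw [h2] at h1
  rw [← h4, h1, Finsupp.sum, AddMonoidAlgebra.coeff_sum, Finsupp.finsetSum_apply]
  simp only [h5]
  rw [Finset.sum_ite_eq']
  split_ifs with hi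
  · rfl
  · rw [Finsupp.notMem_support_iff.1 hi, AddMonoidAlgebra.single_zero]

end Coassoc

variable {S : Scheme.{u}} {T T' P : Over S} {M : Type u} [AddCommGroup M]
  (ρ : RightAction (diagonalizableGroup S M) P)

lemma comp_act_pullChar (f : T' ⟶ T) (p : T ⟶ P) (g : Multiplicative M →* Γ(T.left, ⊤)ˣ) :
    f ≫ ρ.act p g = ρ.act (f ≫ p) (pullChar f g) :=
  ρ.comp_act f p g

section Affine

variable {U : S.Opens} (hU : IsAffineOpen U) (hPU : IsAffineOpen (P.hom ⁻¹ᵁ U))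

/-- The inclusion of the coefficients in a group algebra. -/
noncomputable abbrev coeffHom (A : CommRingCat.{u}) (M : Type u) [AddCommGroup M] :
    A ⟶ CommRingCat.of (AddMonoidAlgebra A M) :=
  CommRingCat.ofHom AddMonoidAlgebra.singleZeroRingHom

/-- The tautological character with values in a group algebra. -/
noncomputable abbrev tautChar (A : CommRingCat.{u}) (M : Type u) [AddCommGroup M] :
    Multiplicative M →* (AddMonoidAlgebra A M)ˣ :=
  (AddMonoidAlgebra.of A M).toHomUnits

/-- The homomorphism of rings corresponding to the action, over an affine open subset. -/
noncomputable def coactionHom :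
    Γ(P.left, P.hom ⁻¹ᵁ U) →+* AddMonoidAlgebra Γ(P.left, P.hom ⁻¹ᵁ U) M :=
  (pullHom (ρ.act (specPoint hU hPU (coeffHom _ M)) (specChar hU _ (tautChar _ M))) U ≫
    specEval hU _).hom

/-- The action on points is given by the coaction. -/
lemma pullHom_act_of_preimage_eq_top (hT : T.hom ⁻¹ᵁ U = ⊤) (p : T ⟶ P)
    (g : Multiplicative M →* Γ(T.left, ⊤)ˣ) :
    (pullHom (ρ.act p g) U).hom =
      (evalAt (pullHom p U).hom (charHom g U)).comp (coactionHom ρ hU hPU) := by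
  set A := Γ(P.left, P.hom ⁻¹ᵁ U)
  let ψ := P.hom.app U ≫ coeffHom A M
  -- `ev` classifies the pair `(p, g)`: the morphism `f` from `T` to `Spec A[M]` which it induces
  -- pulls the universal point and the tautological character back to `p` and `g`. The formula then
  -- follows from functoriality of the action.
  let ev : CommRingCat.of (AddMonoidAlgebra A M) ⟶ Γ(T.left, T.hom ⁻¹ᵁ U) :=
    CommRingCat.ofHom (evalAt (pullHom p U).hom (charHom g U))
  have hev : coeffHom A M ≫ ev = pullHom p U := by
    refine CommRingCat.hom_ext (RingHom.ext fun a => ?_)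
    change evalAt _ _ (AddMonoidAlgebra.single 0 a) = _
    rw [evalAt_single, ofAdd_zero, map_one, mul_one]
  obtain ⟨f, hf⟩ := exists_pullHom_eq (P := specOver hU ψ) hU
    (by rw [specOver_preimage]; exact isAffineOpen_top (Spec _)) hT (specEval hU ψ ≫ ev)
    (by rw [← Category.assoc, app_specEval, Category.assoc, hev, app_pullHom])
  have h1 : f ≫ specPoint hU hPU (coeffHom A M) = p := by
    refine hom_ext_of_preimage_eq_top hPU hT ?_
    rw [pullHom_comp, hf, ← Category.assoc, pullHom_specPoint, hev]
  have h2 : pullChar f (specChar hU ψ (tautChar A M)) = g := by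
    refine charHom_injective hT ?_
    rw [← pullHom_charHom, hf]
    refine MonoidHom.ext fun m => ?_
    have h3 := DFunLike.congr_fun (specEval_charHom hU ψ (tautChar A M)) m
    change ev.hom ((specEval hU ψ).hom.toMonoidHom.comp _ m) = _
    rw [h3]
    change evalAt _ _ (AddMonoidAlgebra.single m.toAdd 1) = _
    rw [evalAt_single, map_one, one_mul]
    rfl
  have h4 : pullHom (ρ.act p g) U = pullHom (ρ.act (specPoint hU hPU (coeffHom _ M))
      (specChar hU _ (tautChar _ M))) U ≫ specEval hU _ ≫ ev := by
    rw [← hf, ← pullHom_comp, comp_act_pullChar, h1, h2]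
  rw [h4]
  rfl

/-- The restriction of an `S`-scheme to the inverse image of an open subset of `S`. -/
noncomputable abbrev restrictBase (T : Over S) (U : S.Opens) : Over S :=
  Over.mk ((T.hom ⁻¹ᵁ U).ι ≫ T.hom)

/-- The inclusion of the inverse image of an open subset of `S`. -/
noncomputable abbrev restrictBaseι (T : Over S) (U : S.Opens) : restrictBase T U ⟶ T :=
  Over.homMk (T.hom ⁻¹ᵁ U).ι

lemma restrictBase_preimage (T : Over S) (U : S.Opens) : (restrictBase T U).hom ⁻¹ᵁ U = ⊤ := by
  rw [eq_top_iff]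
  intro x _
  exact x.2

lemma isIso_pullHom_restrictBaseι (T : Over S) (U : S.Opens) :
    IsIso (pullHom (restrictBaseι T U) U) := by
  have : IsOpenImmersion (restrictBaseι T U).left :=
    inferInstanceAs (IsOpenImmersion (T.hom ⁻¹ᵁ U).ι)
  refine isIso_pullHom _ ?_
  change _ ≤ (T.hom ⁻¹ᵁ U).ι.opensRange
  rw [Scheme.Opens.opensRange_ι]

/-- Both sides concern only sections over the part of `T` above `U`; restricting `p` and `g` to that
part loses nothing. -/
lemma pullHom_act (p : T ⟶ P) (g : Multiplicative M →* Γ(T.left, ⊤)ˣ) :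
    (pullHom (ρ.act p g) U).hom =
      (evalAt (pullHom p U).hom (charHom g U)).comp (coactionHom ρ hU hPU) := by
  have h1 := pullHom_act_of_preimage_eq_top ρ hU hPU (restrictBase_preimage T U)
    (restrictBaseι T U ≫ p) (pullChar (restrictBaseι T U) g)
  have hi := isIso_pullHom_restrictBaseι T U
  rw [← comp_act_pullChar, pullHom_comp, pullHom_comp, CommRingCat.hom_comp, CommRingCat.hom_comp,
    ← pullHom_charHom] at h1
  have h2 := comp_evalAt (pullHom (restrictBaseι T U) U).hom (pullHom p U).hom (charHom g U)
  refine RingHom.ext fun a => (ConcreteCategory.bijective_of_isIso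
    (pullHom (restrictBaseι T U) U)).1 ?_
  refine (DFunLike.congr_fun h1 a).trans ?_
  exact (DFunLike.congr_fun h2 (coactionHom ρ hU hPU a)).symm

lemma pullHom_act_specPoint {B : CommRingCat.{u}} (φ : Γ(P.left, P.hom ⁻¹ᵁ U) ⟶ B)
    (q : specOver hU (P.hom.app U ≫ φ) ⟶ P) (γ : Multiplicative M →* Bˣ) :
    (specEval hU _).hom.comp (pullHom (ρ.act q (specChar hU _ γ)) U).hom =
      (evalAt (pullHom q U ≫ specEval hU _).hom ((Units.coeHom B).comp γ)).comp
        (coactionHom ρ hU hPU) := by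
  rw [pullHom_act ρ hU hPU, ← RingHom.comp_assoc, comp_evalAt, ← specEval_charHom hU]
  rfl

/-- This is the identity `(p g) h = p (g h)` at a point with values in `B`, in the form from which
coassociativity is extracted. -/
lemma evalAt_evalAt_coactionHom {B : CommRingCat.{u}} (φ : Γ(P.left, P.hom ⁻¹ᵁ U) ⟶ B)
    (γ₁ γ₂ : Multiplicative M →* Bˣ) (a : Γ(P.left, P.hom ⁻¹ᵁ U)) :
    evalAt ((evalAt φ.hom ((Units.coeHom B).comp γ₁)).comp (coactionHom ρ hU hPU))
        ((Units.coeHom B).comp γ₂) (coactionHom ρ hU hPU a) =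
      evalAt φ.hom ((Units.coeHom B).comp (γ₁ * γ₂)) (coactionHom ρ hU hPU a) := by
  let p := specPoint hU hPU φ
  let q := ρ.act p (specChar hU _ γ₁)
  have hq : pullHom q U ≫ specEval hU _ = CommRingCat.ofHom
      ((evalAt φ.hom ((Units.coeHom B).comp γ₁)).comp (coactionHom ρ hU hPU)) := by
    refine CommRingCat.hom_ext ((pullHom_act_specPoint ρ hU hPU φ p γ₁).trans ?_)
    rw [pullHom_specPoint]
    rfl
  have h1 := pullHom_act_specPoint ρ hU hPU φ q γ₂
  have h2 := pullHom_act_specPoint ρ hU hPU φ p (γ₁ * γ₂)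
  have h3 : ρ.act q (specChar hU _ γ₂) = ρ.act p (specChar hU _ (γ₁ * γ₂)) := by
    have : specChar hU (P.hom.app U ≫ φ) (γ₁ * γ₂) = specChar hU _ γ₁ * specChar hU _ γ₂ :=
      MonoidHom.comp_mul _ _ _
    rw [this]
    exact (ρ.act_mul p _ _).symm
  rw [h3, h2, pullHom_specPoint, hq] at h1
  exact (DFunLike.congr_fun h1 a).symm

/-- The coaction on the sections over an affine open subset which corresponds to the action. -/
noncomputable def coaction : GroupAlgebraCoaction Γ(P.left, P.hom ⁻¹ᵁ U) M where
  hom := coactionHom ρ hU hPU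
  sum_hom a := by
    -- Counitality is the triviality of the action of `1`, tested on the inclusion of the part of
    -- `P` above `U`, where pullback of sections is bijective.
    have h1 := pullHom_act ρ hU hPU (restrictBaseι P U) 1
    have h2 : ρ.act (restrictBaseι P U) (1 : Multiplicative M →* _) = restrictBaseι P U :=
      ρ.act_one _
    have hi := isIso_pullHom_restrictBaseι P U
    refine (ConcreteCategory.bijective_of_isIso (pullHom (restrictBaseι P U) U)).1 ?_
    rw [h2] at h1
    refine Eq.trans ?_ (DFunLike.congr_fun h1 a).symm
    change _ = evalAt _ _ _
    rw [evalAt_apply, Finsupp.sum, Finsupp.sum]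
    refine (map_sum (pullHom (restrictBaseι P U) U).hom _ _).trans
      (Finset.sum_congr rfl fun i _ => ?_)
    rw [charHom_apply]
    change _ = _ * (topRes _ U).hom 1
    rw [map_one, mul_one]
  hom_coeff := hom_coeff_of_evalAt_evalAt _ fun _ _ φ γ₁ γ₂ a =>
    (evalAt_evalAt_coactionHom ρ hU hPU (CommRingCat.ofHom φ) γ₁ γ₂ a).trans
      (evalAt_apply _ _ _)

end Affine

end

/-! ### Graded pieces, freeness and invariant sections. -/

section

variable {S : Scheme.{u}} {T T' P : Over S} {M : Type u} [AddCommGroup M]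
  (ρ : RightAction (diagonalizableGroup S M) P)

section Affine

variable {U : S.Opens} (hU : IsAffineOpen U) (hPU : IsAffineOpen (P.hom ⁻¹ᵁ U))

/-- The condition on all points is tested on the universal point alone; conversely `pullHom_act`
spreads it to every point. -/
lemma mem_gradedPiece_iff_coaction {i : M} {a : Γ(P.left, P.hom ⁻¹ᵁ U)} :
    a ∈ gradedPiece ρ i U ↔ a ∈ (coaction ρ hU hPU).piece i := by
  constructor
  · intro h
    have h1 := congrArg (specEval hU _).hom
      (h (specPoint hU hPU (coeffHom _ M)) (specChar hU _ (tautChar _ M)))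
    rw [map_mul] at h1
    have h2 : (specEval hU _).hom ((pullHom (specPoint hU hPU (coeffHom _ M)) U).hom a) =
      AddMonoidAlgebra.single 0 a := 
      congrArg (fun k => k.hom a) (pullHom_specPoint hU hPU (coeffHom _ M))
    have h3 := DFunLike.congr_fun (specEval_charHom hU (P.hom.app U ≫ coeffHom _ M)
      (tautChar _ M)) (Multiplicative.ofAdd i)
    refine h1.trans ((congrArg₂ (· * ·) h3 h2).trans ?_)
    change AddMonoidAlgebra.single i 1 * AddMonoidAlgebra.single 0 a = _
    rw [AddMonoidAlgebra.single_mul_single, add_zero, one_mul]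
  · intro h T p g
    refine (DFunLike.congr_fun (pullHom_act ρ hU hPU p g) a).trans ?_
    rw [RingHom.comp_apply]
    have h1 : coactionHom ρ hU hPU a = AddMonoidAlgebra.single i a := h
    rw [h1, evalAt_single, mul_comm]
    rfl

/-- The coaction of a free action is strong. -/
lemma isStrong_coaction (hfree : ρ.IsFree) : (coaction ρ hU hPU).IsStrong := by
  refine GroupAlgebraCoaction.isStrong_of_forall_eq_one _ fun B _ φ γ h => ?_
  let φ' : Γ(P.left, P.hom ⁻¹ᵁ U) ⟶ CommRingCat.of B := CommRingCat.ofHom φ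
  let γ' : Multiplicative M →* (CommRingCat.of B)ˣ := γ
  have h1 := pullHom_act_specPoint ρ hU hPU φ' (specPoint hU hPU φ') γ'
  rw [pullHom_specPoint] at h1
  have h2 : (evalAt φ'.hom ((Units.coeHom B).comp γ)).comp (coactionHom ρ hU hPU) = φ'.hom := by
    refine RingHom.ext fun a => ?_
    induction a using (coaction ρ hU hPU).induction_on with
    | homogeneous i a ha =>
      have h3 : coactionHom ρ hU hPU a = AddMonoidAlgebra.single i a := ha
      rw [RingHom.comp_apply, h3, evalAt_single, mul_comm]
      exact h i a ha
    | add a b ha hb => rw [map_add, map_add, ha, hb]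
  -- The ring-theoretic hypothesis says that the point `φ` is fixed by `γ`, so freeness applies.
  have h3 : ρ.act (specPoint hU hPU φ') (specChar hU _ γ') = specPoint hU hPU φ' := by
    refine hom_ext_of_preimage_eq_top hPU (specOver_preimage hU _) ?_
    rw [← cancel_mono (specEval hU (P.hom.app U ≫ φ')), pullHom_specPoint]
    exact CommRingCat.hom_ext (h1.trans h2)
  have h4 := hfree _ _ h3
  refine MonoidHom.ext fun m => Units.ext ?_
  have h5 := DFunLike.congr_fun (specEval_charHom hU (P.hom.app U ≫ φ') γ') m
  rw [show specChar hU (P.hom.app U ≫ φ') γ' = 1 from h4] at h5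
  refine Eq.trans h5.symm ?_
  change (specEval hU (P.hom.app U ≫ φ')).hom ((topRes _ U).hom 1) = 1
  rw [map_one, map_one]

end Affine

lemma mem_gradedPiece_zero_iff {U : S.Opens} {a : Γ(P.left, P.hom ⁻¹ᵁ U)} :
    a ∈ gradedPiece ρ 0 U ↔ a ∈ ρ.invariantSections U := by
  refine forall₃_congr fun T p g => ?_
  rw [ofAdd_zero, map_one, Units.val_one, map_one, one_mul]

lemma invariantSections_eq_gradedPiece (U : S.Opens) :
    ρ.invariantSections U = gradedPiece ρ 0 U :=
  Set.ext fun _ => (mem_gradedPiece_zero_iff ρ).symm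

/-- The ring of invariant sections. -/
noncomputable def invariantSubring (U : S.Opens) : Subring Γ(P.left, P.hom ⁻¹ᵁ U) where
  carrier := ρ.invariantSections U
  zero_mem' _ p g := ((pullHom (ρ.act p g) U).hom.map_zero).trans (pullHom p U).hom.map_zero.symm
  one_mem' _ p g := ((pullHom (ρ.act p g) U).hom.map_one).trans (pullHom p U).hom.map_one.symm
  add_mem' ha hb _ p g := ((pullHom (ρ.act p g) U).hom.map_add _ _).trans
    ((congrArg₂ (· + ·) (ha p g) (hb p g)).trans ((pullHom p U).hom.map_add _ _).symm)
  mul_mem' ha hb _ p g := ((pullHom (ρ.act p g) U).hom.map_mul _ _).trans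
    ((congrArg₂ (· * ·) (ha p g) (hb p g)).trans ((pullHom p U).hom.map_mul _ _).symm)
  neg_mem' ha _ p g := ((pullHom (ρ.act p g) U).hom.map_neg _).trans
    ((congrArg Neg.neg (ha p g)).trans ((pullHom p U).hom.map_neg _).symm)

lemma invariantSubring_eq_inv {U : S.Opens} (hU : IsAffineOpen U)
    (hPU : IsAffineOpen (P.hom ⁻¹ᵁ U)) :
    invariantSubring ρ U = (coaction ρ hU hPU).inv :=
  SetLike.ext fun _ =>
    (mem_gradedPiece_zero_iff ρ).symm.trans (mem_gradedPiece_iff_coaction ρ hU hPU)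

lemma resHom_mem_invariantSubring {U V : S.Opens} (h : V ≤ U) {a : Γ(P.left, P.hom ⁻¹ᵁ U)}
    (ha : a ∈ invariantSubring ρ U) : (resHom P h).hom a ∈ invariantSubring ρ V := by
  intro T p g
  have h1 (q : T ⟶ P) := congrArg (fun k => k.hom a) (resHom_pullHom q h)
  exact (h1 _).trans ((congrArg (resHom T h).hom (ha p g)).trans (h1 p).symm)

lemma app_mem_invariantSubring {U : S.Opens} (b : Γ(S, U)) :
    (P.hom.app U).hom b ∈ invariantSubring ρ U := by
  intro T p g
  have h1 (q : T ⟶ P) := congrArg (fun k => k.hom b) (app_pullHom q U)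
  exact (h1 _).trans (h1 p).symm

end

/-! ### Localization of invariants and construction of the quotient. -/

section

/-- A subring of a localization is a localization of a subring. -/
lemma isLocalizationAway_restrict {A A' : Type*} [CommRing A] [CommRing A'] (r : A →+* A')
    {B : Subring A} {B' : Subring A'} (hr : ∀ x ∈ B, r x ∈ B') (a : B)
    (hloc : letI := r.toAlgebra; IsLocalization.Away (a : A) A')
    (hmem : ∀ x, r x ∈ B' → ∃ n : ℕ, (a : A) ^ n * x ∈ B)
    (hinv : ∀ y, r a * y = 1 → y ∈ B') :
    letI := (r.restrict B B' hr).toAlgebra; IsLocalization.Away a B' := by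
  let := r.toAlgebra
  let := (r.restrict B B' hr).toAlgebra
  refine ⟨?_, ?_, ?_⟩
  · rintro ⟨_, n, rfl⟩
    obtain ⟨y, hy⟩ := (IsLocalization.Away.algebraMap_isUnit (S := A') (a : A)).exists_right_inv
    have : IsUnit (algebraMap B B' a) :=
      IsUnit.of_mul_eq_one ⟨y, hinv y hy⟩ (Subtype.ext hy)
    change IsUnit (algebraMap B B' (a ^ n))
    rw [map_pow]
    exact this.pow n
  · intro z
    obtain ⟨n, x, hx⟩ := IsLocalization.Away.surj (a : A) (z : A')
    have hx' : r x ∈ B' := by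
      change algebraMap A A' x ∈ B'
      rw [← hx]
      exact B'.mul_mem z.2 (B'.pow_mem (hr _ a.2) n)
    obtain ⟨m, hm⟩ := hmem x hx'
    refine ⟨⟨⟨_, hm⟩, ⟨a ^ (m + n), m + n, rfl⟩⟩, Subtype.ext ?_⟩
    change (z : A') * r ((a : A) ^ (m + n)) = r ((a : A) ^ m * x)
    have hx2 : (z : A') * r a ^ n = r x := hx
    rw [map_mul, ← hx2, map_pow, map_pow]
    ring
  · intro x y hxy
    obtain ⟨⟨_, n, rfl⟩, hc⟩ := IsLocalization.exists_of_eq (M := Submonoid.powers (a : A))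
      (S := A') (show algebraMap A A' x = algebraMap A A' y from congrArg Subtype.val hxy)
    exact ⟨⟨a ^ n, n, rfl⟩, Subtype.ext hc⟩

variable {S : Scheme.{u}} {T T' P : Over S} {M : Type u} [AddCommGroup M]
  (ρ : RightAction (diagonalizableGroup S M) P)

lemma resHom_mem_gradedPiece {i : M} {U V : S.Opens} (h : V ≤ U) {a : Γ(P.left, P.hom ⁻¹ᵁ U)}
    (ha : a ∈ gradedPiece ρ i U) : (resHom P h).hom a ∈ gradedPiece ρ i V := by
  intro T p g
  have h1 (q : T ⟶ P) := congrArg (fun k => k.hom a) (resHom_pullHom q h)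
  have h2 : topRes T U ≫ resHom T h = topRes T V := (T.left.presheaf.map_comp _ _).symm
  refine (h1 _).trans ((congrArg (resHom T h).hom (ha p g)).trans ?_)
  rw [map_mul]
  exact congrArg₂ (· * ·) (congrArg (fun k => k.hom (g (Multiplicative.ofAdd i)).1) h2) (h1 p).symm

/-- Restriction respects degrees because `gradedPiece` is defined by points, without reference to
the affine open subset. -/
lemma resHom_proj_zero {U V : S.Opens} (hU : IsAffineOpen U) (hPU : IsAffineOpen (P.hom ⁻¹ᵁ U))
    (hV : IsAffineOpen V) (hPV : IsAffineOpen (P.hom ⁻¹ᵁ V)) (h : V ≤ U)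
    (x : Γ(P.left, P.hom ⁻¹ᵁ U)) :
    (resHom P h).hom ((coaction ρ hU hPU).proj 0 x) =
      (coaction ρ hV hPV).proj 0 ((resHom P h).hom x) := by
  induction x using (coaction ρ hU hPU).induction_on with
  | homogeneous i x hx =>
    have hx' := (mem_gradedPiece_iff_coaction ρ hV hPV).1
      (resHom_mem_gradedPiece ρ h ((mem_gradedPiece_iff_coaction ρ hU hPU).2 hx))
    by_cases hi : i = 0
    · subst hi
      rw [GroupAlgebraCoaction.proj_same hx, GroupAlgebraCoaction.proj_same hx']
    · rw [GroupAlgebraCoaction.proj_of_ne (Ne.symm hi) hx,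
        GroupAlgebraCoaction.proj_of_ne (Ne.symm hi) hx', map_zero]
  | add x y hx hy => rw [map_add, map_add, map_add, map_add, hx, hy]

lemma mem_invariantSubring_of_mul_eq_one {U : S.Opens} {a b : Γ(P.left, P.hom ⁻¹ᵁ U)}
    (ha : a ∈ invariantSubring ρ U) (hab : a * b = 1) : b ∈ invariantSubring ρ U := by
  intro T p g
  have h1 (q : T ⟶ P) : (pullHom q U).hom a * (pullHom q U).hom b = 1 := by
    rw [← map_mul, hab, map_one]
  have h2 : (pullHom (ρ.act p g) U).hom a = (pullHom p U).hom a := ha p g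
  have h3 := h1 (ρ.act p g)
  rw [h2] at h3
  exact left_inv_eq_right_inv ((mul_comm _ _).trans h3) (h1 p)

lemma isLocalization_resHom {U : S.Opens} (hPU : IsAffineOpen (P.hom ⁻¹ᵁ U)) (f : Γ(S, U)) :
    letI := (resHom P (S.basicOpen_le f)).hom.toAlgebra
    IsLocalization.Away ((P.hom.app U).hom f) Γ(P.left, P.hom ⁻¹ᵁ S.basicOpen f) :=
  hPU.isLocalization_of_eq_basicOpen _ _ (Scheme.preimage_basicOpen _ _)

/-- If `x` becomes invariant over the basic open subset of `f`, then `x` and its degree-zero part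
have the same restriction there, so `f ^ n * x` is invariant for some `n`. The inverse of `f` is
invariant because inverses are unique. -/
lemma isLocalization_invariantSubring {U : S.Opens} (hU : IsAffineOpen U)
    (hPU : IsAffineOpen (P.hom ⁻¹ᵁ U)) (f : Γ(S, U)) :
    letI := ((resHom P (S.basicOpen_le f)).hom.restrict (invariantSubring ρ U)
      (invariantSubring ρ (S.basicOpen f)) fun _ => resHom_mem_invariantSubring ρ _).toAlgebra
    IsLocalization.Away (⟨_, app_mem_invariantSubring ρ f⟩ : invariantSubring ρ U)
      (invariantSubring ρ (S.basicOpen f)) := by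
  have hPV : IsAffineOpen (P.hom ⁻¹ᵁ S.basicOpen f) := by
    rw [Scheme.preimage_basicOpen]
    exact hPU.basicOpen _
  have hloc := isLocalization_resHom hPU f
  refine isLocalizationAway_restrict _ _ _ hloc (fun x hx => ?_) fun y hy =>
    mem_invariantSubring_of_mul_eq_one ρ
      (resHom_mem_invariantSubring ρ _ (app_mem_invariantSubring ρ f)) hy
  have h1 : (resHom P (S.basicOpen_le f)).hom x =
      (resHom P (S.basicOpen_le f)).hom ((coaction ρ hU hPU).proj 0 x) := by
    rw [resHom_proj_zero ρ hU hPU (hU.basicOpen f) hPV]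
    rw [invariantSubring_eq_inv ρ (hU.basicOpen f) hPV] at hx
    exact (GroupAlgebraCoaction.proj_same hx).symm
  let := (resHom P (S.basicOpen_le f)).hom.toAlgebra
  obtain ⟨⟨_, n, rfl⟩, hc⟩ := IsLocalization.exists_of_eq
    (M := Submonoid.powers ((P.hom.app U).hom f)) (S := Γ(P.left, P.hom ⁻¹ᵁ S.basicOpen f)) h1
  refine ⟨n, ?_⟩
  have hc' : (P.hom.app U).hom f ^ n * x =
    (P.hom.app U).hom f ^ n * (coaction ρ hU hPU).proj 0 x := hc
  rw [hc']
  refine Subring.mul_mem _ (Subring.pow_mem _ (app_mem_invariantSubring ρ f) n) ?_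
  rw [invariantSubring_eq_inv ρ hU hPU]
  exact GroupAlgebraCoaction.proj_mem 0 x

/-- Restriction of invariant sections. -/
noncomputable def invariantRes {U V : S.Opens} (h : V ≤ U) :
    CommRingCat.of (invariantSubring ρ U) ⟶ CommRingCat.of (invariantSubring ρ V) :=
  CommRingCat.ofHom ((resHom P h).hom.restrict (invariantSubring ρ _) (invariantSubring ρ _)
    fun _ => resHom_mem_invariantSubring ρ _)

/-- The presheaf of algebras of invariants on the affine open subsets of `S`. -/
noncomputable def invariantFunctor : S.AffineZariskiSiteᵒᵖ ⥤ CommRingCat.{u} where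
  obj U := CommRingCat.of (invariantSubring ρ U.unop.1)
  map i := invariantRes ρ (Scheme.AffineZariskiSite.toOpens_mono (leOfHom i.unop))
  map_id U := by
    refine CommRingCat.hom_ext (RingHom.ext fun a => Subtype.ext ?_)
    exact congrArg (fun k => k.hom a.1) (resHom_self P U.unop.1)
  map_comp {U V W} i j := by
    refine CommRingCat.hom_ext (RingHom.ext fun a => Subtype.ext ?_)
    exact congrArg (fun k => k.hom a.1) (resHom_comp P
      (Scheme.AffineZariskiSite.toOpens_mono (leOfHom i.unop))
      (Scheme.AffineZariskiSite.toOpens_mono (leOfHom j.unop))).symm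

/-- The structure homomorphism of an algebra of invariants. -/
noncomputable def invariantStructureHom (U : S.Opens) :
    Γ(S, U) ⟶ CommRingCat.of (invariantSubring ρ U) :=
  CommRingCat.ofHom ((P.hom.app U).hom.codRestrict (invariantSubring ρ U)
    (app_mem_invariantSubring ρ))

/-- The structure homomorphism of the presheaf of algebras of invariants. -/
noncomputable def invariantNatTrans :
    (Scheme.AffineZariskiSite.toOpensFunctor S).op ⋙ S.presheaf ⟶ invariantFunctor ρ where
  app U := invariantStructureHom ρ U.unop.1
  naturality {U V} i := by
    refine CommRingCat.hom_ext (RingHom.ext fun a => Subtype.ext ?_)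
    exact congrArg (fun k => k.hom a) (app_resHom P
      (Scheme.AffineZariskiSite.toOpens_mono (leOfHom i.unop))).symm

/-- This is the quasi-coherence of the algebra of invariants, which allows its relative spectrum to
be formed. -/
lemma coequifibered_invariantNatTrans [IsAffineHom P.hom] :
    (invariantNatTrans ρ).Coequifibered :=
  Scheme.AffineZariskiSite.coequifibered_iff_forall_isLocalizationAway.2 fun U f =>
    isLocalization_invariantSubring ρ U.2 (IsAffineOpen.preimage U.2 P.hom) f

/-- The data for gluing the spectra of the algebras of invariants. -/
noncomputable def quotientGluingData [IsAffineHom P.hom] :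
    (Scheme.AffineZariskiSite.directedCover S).RelativeGluingData :=
  Scheme.AffineZariskiSite.relativeGluingData (coequifibered_invariantNatTrans ρ)

instance [IsAffineHom P.hom] :
    ((quotientGluingData ρ).functor ⋙ Scheme.forget).IsLocallyDirected :=
  Scheme.Cover.RelativeGluingData.instIsLocallyDirectedI₀CompFunctorForgetOfIsThin ..

/-- The quotient, as the relative spectrum of the algebra of invariants. -/
noncomputable def quotient [IsAffineHom P.hom] : Over S := Over.mk (quotientGluingData ρ).toBase

lemma quotientGluingData_ι_toBase [IsAffineHom P.hom] (U : S.AffineZariskiSite) :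
    Limits.colimit.ι (quotientGluingData ρ).functor U ≫ (quotientGluingData ρ).toBase =
      Spec.map (invariantStructureHom ρ U.1) ≫ IsAffineOpen.fromSpec U.2 :=
  Limits.colimit.ι_desc _ _

/-- The morphism to the quotient from the spectrum of an algebra of invariants. -/
noncomputable def quotientι [IsAffineHom P.hom] {U : S.Opens} (hU : IsAffineOpen U) :
    specOver hU (invariantStructureHom ρ U) ⟶ quotient ρ :=
  Over.homMk (Limits.colimit.ι (quotientGluingData ρ).functor (⟨U, hU⟩ : S.AffineZariskiSite))
    (quotientGluingData_ι_toBase ρ ⟨U, hU⟩)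

instance [IsAffineHom P.hom] {U : S.Opens} (hU : IsAffineOpen U) :
    IsOpenImmersion (quotientι ρ hU).left := by
  let i : (quotientGluingData ρ).cover.I₀ := (⟨U, hU⟩ : S.AffineZariskiSite)
  exact inferInstanceAs (IsOpenImmersion ((quotientGluingData ρ).cover.f i))

lemma opensRange_quotientι [IsAffineHom P.hom] {U : S.Opens} (hU : IsAffineOpen U) :
    (quotientι ρ hU).left.opensRange = (quotient ρ).hom ⁻¹ᵁ U := by
  refine ((quotientGluingData ρ).toBase_preimage_eq_opensRange_ι
    (⟨U, hU⟩ : S.AffineZariskiSite)).symm.trans ?_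
  change (quotientGluingData ρ).toBase ⁻¹ᵁ U.ι.opensRange = _
  rw [Scheme.Opens.opensRange_ι]
  rfl

instance [IsAffineHom P.hom] : IsAffineHom (quotient ρ).hom where
  isAffine_preimage U hU := by
    rw [← opensRange_quotientι ρ hU]
    have : IsAffine (specOver hU (invariantStructureHom ρ U)).left :=
      inferInstanceAs (IsAffine (Spec _))
    exact isAffineOpen_opensRange _

/-- The sections of the quotient over an affine open subset are the invariant sections. -/
noncomputable def quotientSections [IsAffineHom P.hom] {U : S.Opens} (hU : IsAffineOpen U) :
    Γ((quotient ρ).left, (quotient ρ).hom ⁻¹ᵁ U) ⟶ CommRingCat.of (invariantSubring ρ U) :=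
  pullHom (quotientι ρ hU) U ≫ specEval hU _

instance [IsAffineHom P.hom] {U : S.Opens} (hU : IsAffineOpen U) :
    IsIso (quotientSections ρ hU) := by
  have := isIso_pullHom (quotientι ρ hU) (opensRange_quotientι ρ hU).ge
  rw [quotientSections]
  infer_instance

lemma app_quotientSections [IsAffineHom P.hom] {U : S.Opens} (hU : IsAffineOpen U) :
    (quotient ρ).hom.app U ≫ quotientSections ρ hU = invariantStructureHom ρ U := by
  rw [quotientSections, ← Category.assoc, app_pullHom, app_specEval]

end

/-! ### The quotient map. -/

section

variable {S : Scheme.{u}} {T T' P : Over S} {M : Type u} [AddCommGroup M]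
  (ρ : RightAction (diagonalizableGroup S M) P)

lemma pullHom_specOver_map {U V : S.Opens} (hU : IsAffineOpen U) (hV : IsAffineOpen V) (h : V ≤ U)
    {B B' : CommRingCat.{u}} {ψ : Γ(S, U) ⟶ B} {ψ' : Γ(S, V) ⟶ B'} (θ : B ⟶ B')
    (k : specOver hV ψ' ⟶ specOver hU ψ) (hk : k.left = Spec.map θ) :
    pullHom k U ≫ resHom _ h ≫ specEval hV ψ' = specEval hU ψ ≫ θ := by
  have h1 := topRes_specEval hU ψ
  have : IsIso (topRes (specOver hU ψ) U) := by
    have : IsIso (topRes (specOver hU ψ) U ≫ specEval hU ψ) := by rw [h1]; infer_instance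
    exact IsIso.of_isIso_comp_right _ (specEval hU ψ)
  have h2 : topRes (specOver hV ψ') U ≫ resHom _ h = topRes _ V :=
    ((specOver hV ψ').left.presheaf.map_comp _ _).symm
  rw [← cancel_epi (topRes (specOver hU ψ) U), ← Category.assoc, topRes_pullHom, Category.assoc,
    ← Category.assoc (topRes _ U), h2, topRes_specEval, ← Category.assoc, h1, hk]
  exact Scheme.ΓSpecIso_naturality θ

variable [IsAffineHom P.hom]

lemma quotientι_comp {U V : S.Opens} (hU : IsAffineOpen U) (hV : IsAffineOpen V)
    (h : V ≤ U) (hr : ∃ r : Γ(S, U), S.basicOpen r = V) :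
    Spec.map (invariantRes ρ h) ≫ (quotientι ρ hU).left = (quotientι ρ hV).left := by
  let U' : S.AffineZariskiSite := ⟨U, hU⟩
  let V' : S.AffineZariskiSite := ⟨V, hV⟩
  have hle : V' ≤ U' := hr
  exact Limits.colimit.w (quotientGluingData ρ).functor (homOfLE hle)

/-- The transition maps of the gluing exist for basic open subsets only, whence `hr`; the gluing of
morphisms asks for no more. -/
lemma resHom_quotientSections {U V : S.Opens} (hU : IsAffineOpen U) (hV : IsAffineOpen V)
    (h : V ≤ U) (hr : ∃ r : Γ(S, U), S.basicOpen r = V) :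
    resHom (quotient ρ) h ≫ quotientSections ρ hV = quotientSections ρ hU ≫ invariantRes ρ h := by
  have hk := quotientι_comp ρ hU hV h hr
  let k : specOver hV (invariantStructureHom ρ V) ⟶ specOver hU (invariantStructureHom ρ U) :=
    Over.homMk (Spec.map (invariantRes ρ h)) (by
      rw [← Over.w (quotientι ρ hU), ← Over.w (quotientι ρ hV), ← Category.assoc, hk])
  have hk' : k ≫ quotientι ρ hU = quotientι ρ hV := Over.OverMorphism.ext hk
  rw [quotientSections, quotientSections, ← Category.assoc, resHom_pullHom, Category.assoc,
    Category.assoc, ← pullHom_specOver_map hU hV h _ k rfl,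
    ← Category.assoc (pullHom (quotientι ρ hU) U), ← pullHom_comp, hk']

/-- The morphism from `P` to its quotient. -/
lemma exists_quotientMap : ∃ π : P ⟶ quotient ρ, ∀ (U : S.Opens) (hU : IsAffineOpen U),
    pullHom π U = quotientSections ρ hU ≫ CommRingCat.ofHom (invariantSubring ρ U).subtype := by
  suffices h : ∃ π : P ⟶ quotient ρ, ∀ U : S.affineOpens, pullHom π U.1 =
      quotientSections ρ (show IsAffineOpen U.1 from U.2) ≫
        CommRingCat.ofHom (invariantSubring ρ U.1).subtype by
    obtain ⟨π, hπ⟩ := h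
    exact ⟨π, fun U hU => hπ ⟨U, hU⟩⟩
  refine exists_forall_pullHom_eq _ (fun ⟨U, hU⟩ => ?_) fun ⟨U, hU⟩ ⟨V, hV⟩ h hr => ?_
  · exact (Category.assoc _ _ _).symm.trans
      (congrArg (fun k => k ≫ CommRingCat.ofHom (invariantSubring ρ U).subtype)
        (app_quotientSections ρ hU))
  · have h1 := resHom_quotientSections ρ hU hV h hr
    refine (Category.assoc _ _ _).symm.trans ((congrArg (fun k => k ≫ CommRingCat.ofHom
      (invariantSubring ρ V).subtype) h1).trans ?_)
    exact (Category.assoc _ _ _).trans (Category.assoc _ _ _).symm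

/-- A morphism from `P` to an `S`-scheme `X` affine over `S` which identifies the sections of `X`
over the affine open subsets of `S` with the invariant sections of `P`. -/
structure IsInvariantSpectrum {P : Over S} (ρ : RightAction (diagonalizableGroup S M) P)
    {X : Over S} (π : P ⟶ X) : Prop where
  isAffineHom : IsAffineHom X.hom
  injective : ∀ U : S.Opens, IsAffineOpen U → Function.Injective (pullHom π U).hom
  range_eq : ∀ U : S.Opens, IsAffineOpen U → (pullHom π U).hom.range = invariantSubring ρ U

lemma exists_isInvariantSpectrum :
    ∃ (X : Over S) (π : P ⟶ X), IsInvariantSpectrum ρ π := by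
  obtain ⟨π, hπ⟩ := exists_quotientMap ρ
  refine ⟨quotient ρ, π, inferInstance, fun U hU => ?_, fun U hU => ?_⟩
  · rw [hπ U hU]
    exact Subtype.val_injective.comp
      (ConcreteCategory.bijective_of_isIso (quotientSections ρ hU)).1
  · rw [hπ U hU]
    refine SetLike.ext fun a => ⟨?_, fun ha => ?_⟩
    · rintro ⟨x, rfl⟩
      exact ((quotientSections ρ hU).hom x).2
    · obtain ⟨x, hx⟩ := (ConcreteCategory.bijective_of_isIso (quotientSections ρ hU)).2 ⟨a, ha⟩
      exact ⟨x, congrArg Subtype.val hx⟩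

end

/-! ### Invariance of `π`, and invariant sections over arbitrary open subsets. -/

section

variable {S : Scheme.{u}} {T T' P X : Over S} {M : Type u} [AddCommGroup M]

/-- Sections which agree over the affine open subsets of the base are equal. -/
lemma eq_of_resHom_eq {U : S.Opens} {a b : Γ(T.left, T.hom ⁻¹ᵁ U)}
    (h : ∀ (V : S.Opens) (_ : IsAffineOpen V) (hV : V ≤ U),
      (resHom T hV).hom a = (resHom T hV).hom b) : a = b := by
  refine T.left.sheaf.eq_of_locally_eq'
    (fun V : {V : S.Opens // IsAffineOpen V ∧ V ≤ U} => T.hom ⁻¹ᵁ V.1) (T.hom ⁻¹ᵁ U)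
    (fun V => homOfLE (T.hom.preimage_mono V.2.2)) (fun x hx => ?_) a b
    fun V => h V.1 V.2.1 V.2.2
  obtain ⟨_, ⟨V, hV, rfl⟩, hxV, hVU⟩ :=
    S.isBasis_affineOpens.exists_subset_of_mem_open (show T.hom x ∈ U from hx) U.2
  exact TopologicalSpace.Opens.mem_iSup.2 ⟨⟨V, hV, hVU⟩, hxV⟩

/-- Compatible sections over the affine open subsets of the base can be glued. -/
lemma exists_resHom_eq {U : S.Opens}
    (s : ∀ (V : S.Opens), IsAffineOpen V → V ≤ U → Γ(T.left, T.hom ⁻¹ᵁ V))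
    (hs : ∀ (V W : S.Opens) (hV : IsAffineOpen V) (hVU : V ≤ U) (hW : IsAffineOpen W)
      (h : W ≤ V), (resHom T h).hom (s V hV hVU) = s W hW (h.trans hVU)) :
    ∃ a, ∀ (V : S.Opens) (hV : IsAffineOpen V) (hVU : V ≤ U),
      (resHom T hVU).hom a = s V hV hVU := by
  have hcover : T.hom ⁻¹ᵁ U ≤ ⨆ V : {V : S.Opens // IsAffineOpen V ∧ V ≤ U}, T.hom ⁻¹ᵁ V.1 := by
    intro x hx
    obtain ⟨_, ⟨V, hV, rfl⟩, hxV, hVU⟩ :=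
      S.isBasis_affineOpens.exists_subset_of_mem_open (show T.hom x ∈ U from hx) U.2
    exact TopologicalSpace.Opens.mem_iSup.2 ⟨⟨V, hV, hVU⟩, hxV⟩
  have hcompat : TopCat.Presheaf.IsCompatible T.left.sheaf.1
      (fun V : {V : S.Opens // IsAffineOpen V ∧ V ≤ U} => T.hom ⁻¹ᵁ V.1)
      fun V => s V.1 V.2.1 V.2.2 := by
    rintro ⟨V, hV, hVU⟩ ⟨W, hW, hWU⟩
    refine eq_of_resHom_eq (T := T) (U := V ⊓ W) fun Z hZ hle => ?_
    have h1 := congrArg (fun k => k.hom (s V hV hVU)) (resHom_comp T (inf_le_left : V ⊓ W ≤ V) hle)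
    have h2 := congrArg (fun k => k.hom (s W hW hWU)) (resHom_comp T (inf_le_right : V ⊓ W ≤ W) hle)
    exact (h1.trans (hs V Z hV hVU hZ _)).trans (h2.trans (hs W Z hW hWU hZ _)).symm
  obtain ⟨a, ha, -⟩ := T.left.sheaf.existsUnique_gluing' _ (T.hom ⁻¹ᵁ U)
    (fun V => homOfLE (T.hom.preimage_mono V.2.2)) hcover _ hcompat
  exact ⟨a, fun V hV hVU => ha ⟨V, hV, hVU⟩⟩

variable {ρ : RightAction (diagonalizableGroup S M) P} {π : P ⟶ X}

namespace IsInvariantSpectrum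

variable (h : IsInvariantSpectrum ρ π)

include h

lemma isInvariant : ρ.IsInvariant π := by
  intro T p g
  have := h.isAffineHom
  refine hom_ext_of_pullHom_eq fun ⟨U, hU⟩ => ?_
  rw [pullHom_comp, pullHom_comp]
  refine CommRingCat.hom_ext (RingHom.ext fun x => ?_)
  have hx : (pullHom π U).hom x ∈ invariantSubring ρ U := by
    rw [← h.range_eq U hU]
    exact ⟨x, rfl⟩
  exact hx p g

lemma injective_pullSection (U : S.Opens) :
    Function.Injective (RightAction.pullSection π U) := by
  intro a b hab
  refine eq_of_resHom_eq fun V hV hVU => h.injective V hV ?_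
  have h1 (x) := congrArg (fun k => k.hom x) (resHom_pullHom π hVU)
  exact (h1 a).trans ((congrArg (resHom P hVU).hom hab).trans (h1 b).symm)

/-- An invariant section descends over each affine open subset of `U`; injectivity of `π` on
sections makes these descents compatible, and they glue. -/
lemma range_pullSection (U : S.Opens) :
    Set.range (RightAction.pullSection π U) = ρ.invariantSections U := by
  refine Set.Subset.antisymm ?_ fun s hs => ?_
  · rintro _ ⟨x, rfl⟩ T p g
    have h1 := congrArg (fun k => (pullHom k U).hom x) (h.isInvariant p g)
    have h2 (q : T ⟶ P) := congrArg (fun k => k.hom x) (pullHom_comp q π U)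
    exact (h2 _).symm.trans (h1.trans (h2 _))
  · have h1 (V : S.Opens) (hV : IsAffineOpen V) (hVU : V ≤ U) :
        ∃ x, (pullHom π V).hom x = (resHom P hVU).hom s := by
      have h2 : (resHom P hVU).hom s ∈ invariantSubring ρ V := resHom_mem_invariantSubring ρ hVU hs
      rw [← h.range_eq V hV] at h2
      exact h2
    choose x hx using h1
    obtain ⟨a, ha⟩ := exists_resHom_eq x fun V W hV hVU hW hWV => by
      refine h.injective W hW ?_
      rw [hx]
      refine (congrArg (fun k => k.hom (x V hV hVU)) (resHom_pullHom π hWV)).trans ?_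
      refine (congrArg (resHom P hWV).hom (hx V hV hVU)).trans ?_
      exact congrArg (fun k => k.hom s) (resHom_comp P hVU hWV)
    refine ⟨a, eq_of_resHom_eq fun V hV hVU => ?_⟩
    refine (congrArg (fun k => k.hom a) (resHom_pullHom π hVU)).symm.trans ?_
    rw [← hx V hV hVU, ← ha V hV hVU]
    rfl

end IsInvariantSpectrum

end

/-! ### The fibres of `π` are simply transitive orbits. -/

section

variable {S : Scheme.{u}} {T T' P X : Over S} {M : Type u} [AddCommGroup M]
  {ρ : RightAction (diagonalizableGroup S M) P} {π : P ⟶ X}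

lemma RightAction.IsFree.eq_of_act_eq {G : (Over S)ᵒᵖ ⥤ GrpCat.{u}} {ρ : RightAction G P}
    (hfree : ρ.IsFree) (p : T ⟶ P) {g g' : G.obj (op T)} (h : ρ.act p g = ρ.act p g') :
    g = g' := by
  refine eq_of_mul_inv_eq_one (hfree p _ ?_)
  rw [ρ.act_mul, h, ← ρ.act_mul, mul_inv_cancel, ρ.act_one]

lemma exists_charHom_eq {U : S.Opens} (hT : T.hom ⁻¹ᵁ U = ⊤)
    (γ : Multiplicative M →* Γ(T.left, T.hom ⁻¹ᵁ U)) :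
    ∃ g : Multiplicative M →* Γ(T.left, ⊤)ˣ, charHom g U = γ := by
  have := isIso_topRes hT
  refine ⟨((inv (topRes T U)).hom.toMonoidHom.comp γ).toHomUnits, MonoidHom.ext fun m => ?_⟩
  exact congrArg (fun k => k.hom (γ m)) (IsIso.inv_hom_id (topRes T U))

/-- The inclusion of the inverse image of a smaller open subset of the base. -/
noncomputable abbrev restrictBaseMap (T : Over S) {U V : S.Opens} (h : V ≤ U) :
    restrictBase T V ⟶ restrictBase T U :=
  Over.homMk (T.left.homOfLE (T.hom.preimage_mono h)) (by
    change _ ≫ (T.hom ⁻¹ᵁ U).ι ≫ T.hom = (T.hom ⁻¹ᵁ V).ι ≫ T.hom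
    rw [← Category.assoc, Scheme.homOfLE_ι])

lemma restrictBaseMap_comp (T : Over S) {U V : S.Opens} (h : V ≤ U) :
    restrictBaseMap T h ≫ restrictBaseι T U = restrictBaseι T V :=
  Over.OverMorphism.ext (Scheme.homOfLE_ι T.left (T.hom.preimage_mono h))

lemma resHom_charHom (g : Multiplicative M →* Γ(T.left, ⊤)ˣ) {U V : S.Opens} (h : V ≤ U)
    (m : Multiplicative M) : (resHom T h).hom (charHom g U m) = charHom g V m :=
  congrArg (fun k => k.hom (g m : Γ(T.left, ⊤)))
    (T.left.presheaf.map_comp (homOfLE le_top).op (homOfLE (T.hom.preimage_mono h)).op).symm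

namespace IsInvariantSpectrum

variable (h : IsInvariantSpectrum ρ π)

include h

/-- Equality after `π` says that the two homomorphisms on sections agree on `A_0`, so strength
provides a character relating them. Its values are units automatically, since its source is a group.
-/
lemma exists_act_eq_of_preimage_eq_top [IsAffineHom P.hom] (hfree : ρ.IsFree) {U : S.Opens}
    (hU : IsAffineOpen U) (hT : T.hom ⁻¹ᵁ U = ⊤) {p q : T ⟶ P} (hpq : p ≫ π = q ≫ π) :
    ∃ g : Multiplicative M →* Γ(T.left, ⊤)ˣ, ρ.act p g = q := by
  have hPU : IsAffineOpen (P.hom ⁻¹ᵁ U) := hU.preimage P.hom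
  have h1 : ∀ a ∈ (coaction ρ hU hPU).inv, (pullHom p U).hom a = (pullHom q U).hom a := by
    intro a ha
    rw [← invariantSubring_eq_inv, ← h.range_eq U hU] at ha
    obtain ⟨x, rfl⟩ := ha
    have h2 := congrArg (fun k => (pullHom k U).hom x) hpq
    rwa [pullHom_comp, pullHom_comp] at h2
  obtain ⟨γ, hγ, -⟩ := (isStrong_coaction ρ hU hPU hfree).existsUnique_monoidHom _ _ h1
  obtain ⟨g, rfl⟩ := exists_charHom_eq hT γ
  refine ⟨g, hom_ext_of_preimage_eq_top hPU hT (CommRingCat.hom_ext (RingHom.ext fun a => ?_))⟩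
  rw [pullHom_act ρ hU hPU]
  induction a using (coaction ρ hU hPU).induction_on with
  | homogeneous i a ha =>
    have h3 : coactionHom ρ hU hPU a = AddMonoidAlgebra.single i a := ha
    rw [RingHom.comp_apply, h3, evalAt_single, hγ i a ha, mul_comm]
  | add a b ha hb => rw [map_add, map_add, ha, hb]

lemma exists_act_eq [IsAffineHom P.hom] (hfree : ρ.IsFree) {p q : T ⟶ P}
    (hpq : p ≫ π = q ≫ π) : ∃ g : Multiplicative M →* Γ(T.left, ⊤)ˣ, ρ.act p g = q := by
  have h1 (U : S.Opens) (hU : IsAffineOpen U) := h.exists_act_eq_of_preimage_eq_top hfree hU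
    (restrictBase_preimage T U) (p := restrictBaseι T U ≫ p) (q := restrictBaseι T U ≫ q)
    (by rw [Category.assoc, hpq, Category.assoc])
  choose g hg using h1
  -- Freeness makes the local group elements unique, hence compatible with restriction.
  have hres (U V : S.Opens) (hU : IsAffineOpen U) (hV : IsAffineOpen V) (hle : V ≤ U) :
      pullChar (restrictBaseMap T hle) (g U hU) = g V hV := by
    refine hfree.eq_of_act_eq (restrictBaseι T V ≫ p) ?_
    refine Eq.trans ?_ (hg V hV).symm
    rw [← restrictBaseMap_comp T hle, Category.assoc, ← comp_act_pullChar, hg, Category.assoc]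
  have hiso := isIso_pullHom_restrictBaseι T
  have hinj (U : S.Opens) := (ConcreteCategory.bijective_of_isIso (pullHom (restrictBaseι T U) U)).1
  let s (U : S.Opens) (hU : IsAffineOpen U) : Multiplicative M →* Γ(T.left, T.hom ⁻¹ᵁ U) :=
    (inv (pullHom (restrictBaseι T U) U)).hom.toMonoidHom.comp (charHom (g U hU) U)
  have hs (U : S.Opens) (hU : IsAffineOpen U) (m) :
      (pullHom (restrictBaseι T U) U).hom (s U hU m) = charHom (g U hU) U m :=
    congrArg (fun k => k.hom (charHom (g U hU) U m))
      (IsIso.inv_hom_id (pullHom (restrictBaseι T U) U))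
  have hcomp (U V : S.Opens) (hU : IsAffineOpen U) (hV : IsAffineOpen V) (hle : V ≤ U) (m) :
      (resHom T hle).hom (s U hU m) = s V hV m := by
    refine hinj V ?_
    refine Eq.trans ?_ (hs V hV m).symm
    refine (congrArg (fun k => k.hom (s U hU m)) (resHom_pullHom (restrictBaseι T V) hle)).trans ?_
    rw [← restrictBaseMap_comp T hle, pullHom_comp]
    refine (congrArg (fun x => (resHom (restrictBase T V) hle).hom
      ((pullHom (restrictBaseMap T hle) U).hom x)) (hs U hU m)).trans ?_
    have h2 := DFunLike.congr_fun (pullHom_charHom (restrictBaseMap T hle) (g U hU) U) m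
    rw [hres U V hU hV hle] at h2
    exact (congrArg (resHom (restrictBase T V) hle).hom h2).trans (resHom_charHom _ hle m)
  -- The values of the characters are glued separately for each `m`; multiplicativity is then
  -- checked locally.
  have hglue (m : Multiplicative M) := exists_resHom_eq (T := T) (U := ⊤)
    (fun V hV _ => s V hV m) fun V W hV _ hW hle => hcomp V W hV hW hle m
  choose a ha using hglue
  let γ : Multiplicative M →* Γ(T.left, T.hom ⁻¹ᵁ ⊤) :=
    { toFun := a
      map_one' := eq_of_resHom_eq fun V hV hle => by rw [ha _ V hV, map_one, map_one]
      map_mul' := fun m n => eq_of_resHom_eq fun V hV hle => by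
        rw [ha _ V hV, map_mul, map_mul, ha _ V hV, ha _ V hV] }
  obtain ⟨g₀, hg₀⟩ := exists_charHom_eq (T := T) (U := ⊤) rfl γ
  have hs₀ (U : S.Opens) (hU : IsAffineOpen U) : pullChar (restrictBaseι T U) g₀ = g U hU := by
    refine charHom_injective (restrictBase_preimage T U) ?_
    rw [← pullHom_charHom]
    refine MonoidHom.ext fun m => Eq.trans ?_ (hs U hU m)
    refine congrArg (pullHom (restrictBaseι T U) U).hom ?_
    rw [← resHom_charHom g₀ le_top, hg₀]
    exact ha m U hU le_top
  refine ⟨g₀, Over.OverMorphism.ext (Scheme.Cover.hom_ext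
    (T.left.openCoverOfIsOpenCover _ (isOpenCover_preimage T)) _ _ fun ⟨U, hU⟩ => ?_)⟩
  have h3 : restrictBaseι T U ≫ ρ.act p g₀ = restrictBaseι T U ≫ q := by
    rw [comp_act_pullChar, hs₀ U hU]
    exact hg U hU
  exact congrArg Over.Hom.left h3

lemma existsUnique_act_eq [IsAffineHom P.hom] (hfree : ρ.IsFree) {p q : T ⟶ P}
    (hpq : p ≫ π = q ≫ π) : ∃! g : (diagonalizableGroup S M).obj (op T), ρ.act p g = q := by
  obtain ⟨g, hg⟩ := h.exists_act_eq hfree hpq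
  exact ⟨g, hg, fun g' hg' => hfree.eq_of_act_eq p (hg'.trans hg.symm)⟩

end IsInvariantSpectrum

end

/-! ### Flatness, finiteness and the universal properties of the quotient. -/

section

open Limits

variable {S : Scheme.{u}} {T T' P X : Over S} {M : Type u} [AddCommGroup M]
  {ρ : RightAction (diagonalizableGroup S M) P} {π : P ⟶ X}

lemma exists_isAffineOpen_mem (x : S) : ∃ U : S.Opens, IsAffineOpen U ∧ x ∈ U := by
  obtain ⟨_, ⟨U, hU, rfl⟩, hx, -⟩ :=
    S.isBasis_affineOpens.exists_subset_of_mem_open (Set.mem_univ x) isOpen_univ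
  exact ⟨U, hU, hx⟩

section RingHomProperty

variable (W : MorphismProperty Scheme.{u})
  {Q : ∀ {A B : Type u} [CommRing A] [CommRing B], (A →+* B) → Prop} [HasRingHomProperty W Q]
  (hQ : RingHom.StableUnderCompositionWithLocalizationAwaySource Q)

include hQ

/-- The inverse images of affine open subsets of `S` form affine covers of both source and target,
on which a local property can be tested. -/
lemma of_forall_pullHom [IsAffineHom T.hom] [IsAffineHom P.hom] (f : T ⟶ P)
    (h : ∀ U : S.Opens, IsAffineOpen U → Q (pullHom f U).hom) : W f.left := by
  refine (HasRingHomProperty.iff_exists_appLE hQ).2 fun x => ?_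
  obtain ⟨U, hU, hx⟩ := exists_isAffineOpen_mem (T.hom x)
  exact ⟨⟨_, hU.preimage P.hom⟩, ⟨_, hU.preimage T.hom⟩, hx, preimage_le_preimage f U, h U hU⟩

lemma of_forall_app [IsAffineHom T.hom]
    (h : ∀ U : S.Opens, IsAffineOpen U → Q (T.hom.app U).hom) : W T.hom := by
  refine (HasRingHomProperty.iff_exists_appLE hQ).2 fun x => ?_
  obtain ⟨U, hU, hx⟩ := exists_isAffineOpen_mem (T.hom x)
  refine ⟨⟨_, hU⟩, ⟨_, hU.preimage T.hom⟩, hx, le_rfl, ?_⟩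
  change Q (T.hom.appLE U _ le_rfl).hom
  rw [Scheme.Hom.appLE_eq_app]
  exact h U hU

end RingHomProperty

lemma surjective_of_forall_pullHom [IsAffineHom T.hom] [IsAffineHom P.hom] (f : T ⟶ P)
    (h : ∀ U : S.Opens, IsAffineOpen U →
      Function.Surjective (PrimeSpectrum.comap (pullHom f U).hom)) :
    Surjective f.left := by
  refine ⟨fun x => ?_⟩
  obtain ⟨U, hU, hx⟩ := exists_isAffineOpen_mem (P.hom x)
  have hPU := hU.preimage P.hom
  have hTU := hU.preimage T.hom
  have hx' : x ∈ Set.range hPU.fromSpec := by rw [hPU.range_fromSpec]; exact hx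
  obtain ⟨y, rfl⟩ := hx'
  obtain ⟨z, rfl⟩ := h U hU y
  refine ⟨hTU.fromSpec z, ?_⟩
  exact (congrArg (fun k => k.base z)
    (IsAffineOpen.SpecMap_appLE_fromSpec f.left hPU hTU (preimage_le_preimage f U))).symm

namespace IsInvariantSpectrum

variable (h : IsInvariantSpectrum ρ π) [IsAffineHom P.hom]

include h

lemma exists_ringEquiv {U : S.Opens} (hU : IsAffineOpen U) :
    ∃ e : Γ(X.left, X.hom ⁻¹ᵁ U) ≃+* (coaction ρ hU (hU.preimage P.hom)).inv,
      (pullHom π U).hom = (coaction ρ hU (hU.preimage P.hom)).inv.subtype.comp e.toRingHom := by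
  have h1 : (pullHom π U).hom.range = (coaction ρ hU (hU.preimage P.hom)).inv := by
    rw [h.range_eq U hU, invariantSubring_eq_inv]
  have h2 (x) : (pullHom π U).hom x ∈ (coaction ρ hU (hU.preimage P.hom)).inv := by
    rw [← h1]
    exact ⟨x, rfl⟩
  refine ⟨RingEquiv.ofBijective ((pullHom π U).hom.codRestrict _ h2) ⟨fun a b hab =>
    h.injective U hU (congrArg Subtype.val hab), fun ⟨b, hb⟩ => ?_⟩, rfl⟩
  rw [← h1] at hb
  obtain ⟨x, hx⟩ := hb
  exact ⟨x, Subtype.ext hx⟩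

lemma faithfullyFlat (hfree : ρ.IsFree) {U : S.Opens} (hU : IsAffineOpen U) :
    (pullHom π U).hom.FaithfullyFlat := by
  obtain ⟨e, he⟩ := h.exists_ringEquiv hU
  rw [he]
  exact RingHom.FaithfullyFlat.stableUnderComposition _ _ (.of_bijective e.bijective)
    (isStrong_coaction ρ hU _ hfree).faithfullyFlat

lemma flat (hfree : ρ.IsFree) : Flat π.left :=
  have := h.isAffineHom
  of_forall_pullHom @Flat
    (RingHom.Flat.stableUnderComposition.stableUnderCompositionWithLocalizationAway
    RingHom.Flat.holdsForLocalizationAway).left π fun _ hU => (h.faithfullyFlat hfree hU).flat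

lemma surjective (hfree : ρ.IsFree) : Surjective π.left :=
  have := h.isAffineHom
  surjective_of_forall_pullHom π fun _ hU =>
    (RingHom.FaithfullyFlat.iff_flat_and_comap_surjective.1 (h.faithfullyFlat hfree hU)).2

lemma quasiCompact : QuasiCompact π.left := by
  have := h.isAffineHom
  have h1 : QuasiCompact (π.left ≫ X.hom) := by
    rw [Over.w π]
    infer_instance
  exact .of_comp π.left X.hom

lemma locallyOfFinitePresentation (hfree : ρ.IsFree) [AddGroup.FG M] :
    LocallyOfFinitePresentation π.left := by
  have := h.isAffineHom
  have : AddMonoid.FG M := AddGroup.fg_iff_addMonoid_fg.1 inferInstance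
  refine of_forall_pullHom @LocallyOfFinitePresentation
    (RingHom.finitePresentation_stableUnderComposition.stableUnderCompositionWithLocalizationAway
      RingHom.finitePresentation_holdsForLocalizationAway).left π fun U hU => ?_
  obtain ⟨e, he⟩ := h.exists_ringEquiv hU
  rw [he]
  exact (isStrong_coaction ρ hU _ hfree).finitePresentation.comp (.of_bijective e.bijective)

lemma isOfFiniteType (hP : IsOfFiniteType P.hom) : IsOfFiniteType X.hom := by
  have := h.isAffineHom
  have := hP.1
  refine ⟨of_forall_app @LocallyOfFiniteType
    (RingHom.finiteType_stableUnderComposition.stableUnderCompositionWithLocalizationAway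
      RingHom.finiteType_holdsForLocalizationAway).left fun U hU => ?_, inferInstance⟩
  obtain ⟨e, he⟩ := h.exists_ringEquiv hU
  have h1 : (P.hom.app U).hom = (coaction ρ hU (hU.preimage P.hom)).inv.subtype.comp
      (e.toRingHom.comp (X.hom.app U).hom) := by
    rw [← RingHom.comp_assoc, ← he, ← app_pullHom π]
    rfl
  have h2 : (P.hom.app U).hom.FiniteType := by
    rw [Scheme.Hom.app_eq_appLE]
    exact P.hom.finiteType_appLE hU (hU.preimage P.hom) le_rfl
  rw [h1] at h2
  have h3 := (coaction ρ hU (hU.preimage P.hom)).finiteType_inv _ h2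
  have h4 := (RingHom.FiniteType.of_surjective e.symm.toRingHom e.symm.surjective).comp h3
  rw [← RingHom.comp_assoc] at h4
  have h5 : e.symm.toRingHom.comp e.toRingHom = RingHom.id _ := RingHom.ext e.symm_apply_apply
  rwa [h5, RingHom.id_comp] at h4

lemma isOfFinitePresentation (hP : IsOfFinitePresentation P.hom) :
    IsOfFinitePresentation X.hom := by
  have := h.isAffineHom
  have := hP.1
  refine ⟨of_forall_app @LocallyOfFinitePresentation
    (RingHom.finitePresentation_stableUnderComposition.stableUnderCompositionWithLocalizationAway
      RingHom.finitePresentation_holdsForLocalizationAway).left fun U hU => ?_, inferInstance,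
        inferInstance⟩
  obtain ⟨e, he⟩ := h.exists_ringEquiv hU
  have h1 : (P.hom.app U).hom = (coaction ρ hU (hU.preimage P.hom)).inv.subtype.comp
      (e.toRingHom.comp (X.hom.app U).hom) := by
    rw [← RingHom.comp_assoc, ← he, ← app_pullHom π]
    rfl
  have h2 : (P.hom.app U).hom.FinitePresentation := by
    rw [Scheme.Hom.app_eq_appLE]
    exact P.hom.finitePresentation_appLE hU (hU.preimage P.hom) le_rfl
  rw [h1] at h2
  have h3 := (coaction ρ hU (hU.preimage P.hom)).finitePresentation_inv _ h2
  have h4 := (RingHom.FinitePresentation.of_bijective (f := e.symm.toRingHom)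
    e.symm.bijective).comp h3
  rw [← RingHom.comp_assoc] at h4
  have h5 : e.symm.toRingHom.comp e.toRingHom = RingHom.id _ := RingHom.ext e.symm_apply_apply
  rwa [h5, RingHom.id_comp] at h4

/-- Flat, surjective and quasi-compact, `π` is an effective epimorphism of schemes. Two points with
the same image under `π` differ by a group element, so an invariant morphism coequalizes them. -/
lemma isCategoricalQuotient (hfree : ρ.IsFree) : ρ.IsCategoricalQuotient π := by
  have := h.flat hfree
  have := h.surjective hfree
  have := h.quasiCompact
  refine ⟨h.isInvariant, fun Z v hv => ?_⟩
  have h1 {W : Scheme.{u}} (a b : W ⟶ P.left) (hab : a ≫ π.left = b ≫ π.left) :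
      a ≫ v = b ≫ v := by
    have hb : b ≫ P.hom = a ≫ P.hom := by
      rw [← Over.w π, ← Category.assoc, ← hab, Category.assoc]
    let p : Over.mk (a ≫ P.hom) ⟶ P := Over.homMk a
    let q : Over.mk (a ≫ P.hom) ⟶ P := Over.homMk b hb
    obtain ⟨g, hg⟩ := h.exists_act_eq hfree (p := p) (q := q) (Over.OverMorphism.ext hab)
    have h2 := hv p g
    rw [hg] at h2
    exact h2.symm
  exact ⟨EffectiveEpi.desc π.left v h1, EffectiveEpi.fac π.left v h1,
    fun w hw => EffectiveEpi.uniq π.left v h1 w hw⟩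

lemma isFpqcTorsor (hfree : ρ.IsFree) (hπ : ρ.IsInvariant π) :
    (ρ.overInvariant π hπ).IsFpqcTorsor := by
  have := h.flat hfree
  have := h.surjective hfree
  have := h.quasiCompact
  -- The covering is `π` itself, over which `P` has its identity as a section.
  refine ⟨fun U p q => ?_, Presieve.singleton π.left,
    Scheme.Hom.singleton_mem_fpqcPrecoverage _, ?_⟩
  · obtain ⟨g, hg, hg'⟩ := h.existsUnique_act_eq hfree
      (p := RightAction.forgetBase π p) (q := RightAction.forgetBase π q)
      (Over.OverMorphism.ext ((Over.w p).trans (Over.w q).symm))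
    refine ⟨g, Over.OverMorphism.ext ?_, fun g' h' => hg' g' (Over.OverMorphism.ext ?_)⟩
    · have h1 := congrArg (fun k => Over.Hom.left k) hg
      exact h1
    · have h1 := congrArg (fun k => Over.Hom.left k) h'
      exact h1
  · rintro _ _ ⟨⟩
    exact ⟨𝟙 _⟩

/-- The orbit presheaf already injects into the points of `X`, before any localization, and a point
`s` of `X` lifts to `P` over the base change of `π` along `s`. The topology must therefore only be
subcanonical and contain these base changes, which serves fpqc and fppf alike. -/
lemma representsQuotientSheaf (hfree : ρ.IsFree) (hπ : ρ.IsInvariant π)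
    (J : GrothendieckTopology Scheme.{u}) [J.Subcanonical]
    (hJ : ∀ {U : Scheme.{u}} (s : U ⟶ X.left),
      Sieve.generate (Presieve.singleton (pullback.snd π.left s)) ∈ J U) :
    ρ.RepresentsQuotientSheaf (J.over S) π hπ where
  isSheaf := (isSheaf_iff_isSheaf_of_type _ _).2
    (GrothendieckTopology.Subcanonical.isSheaf_of_isRepresentable _)
  locallyInjective := by
    refine Presheaf.isLocallyInjective_of_injective _ _ fun U x y hxy => ?_
    induction x using Quotient.inductionOn with
    | h p =>
      induction y using Quotient.inductionOn with
      | h q => exact Quotient.sound (h.exists_act_eq hfree hxy)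
  locallySurjective := by
    refine ⟨fun {U} s => ?_⟩
    rw [GrothendieckTopology.mem_over_iff]
    refine J.superset_covering ?_ (hJ s.left)
    rw [Sieve.generate_le_iff]
    rintro _ _ ⟨⟩
    rw [Sieve.overEquiv_iff]
    let p : Over.mk (pullback.snd π.left s.left ≫ U.hom) ⟶ P :=
      Over.homMk (pullback.fst π.left s.left) (by
        rw [← Over.w π, ← Category.assoc, pullback.condition, Category.assoc, Over.w s]
        rfl)
    refine ⟨Quotient.mk _ p, ?_⟩
    exact Over.OverMorphism.ext pullback.condition

end IsInvariantSpectrum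

end

end SchemeQuotient

theorem mainTheorem6 (S : Scheme.{u}) (M : Type u) [AddCommGroup M] (P : Over S)
    (hP : IsAffineHom P.hom)
    (ρ : SchemeQuotient.RightAction (SchemeQuotient.diagonalizableGroup S M) P)
    (hfree : ρ.IsFree) :
    ∃ (X : Over S) (π : P ⟶ X) (hπ : ρ.IsInvariant π),
      -- `X` is the quotient `P/G`
      ρ.RepresentsQuotientSheaf (Scheme.fpqcTopology.over S) π hπ ∧
      (AddGroup.FG M → ρ.RepresentsQuotientSheaf (Scheme.fppfTopology.over S) π hπ) ∧
      ρ.IsCategoricalQuotient π ∧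
      -- `P` is a torsor under `G_X` over `X`
      (ρ.overInvariant π hπ).IsFpqcTorsor ∧
      -- `X` is affine over `S`, and it is the spectrum of the algebra of invariants
      IsAffineHom X.hom ∧
      (∀ U : S.Opens,
        Function.Injective
          (SchemeQuotient.RightAction.pullSection π U :
            Γ(X.left, X.hom ⁻¹ᵁ U) → Γ(P.left, P.hom ⁻¹ᵁ U)) ∧
        Set.range (SchemeQuotient.RightAction.pullSection π U) = ρ.invariantSections U ∧
        ρ.invariantSections U = SchemeQuotient.gradedPiece ρ 0 U) ∧
      (SchemeQuotient.IsOfFiniteType P.hom → SchemeQuotient.IsOfFiniteType X.hom) ∧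
      (SchemeQuotient.IsOfFinitePresentation P.hom →
        SchemeQuotient.IsOfFinitePresentation X.hom) := by
  obtain ⟨X, π, h⟩ := SchemeQuotient.exists_isInvariantSpectrum ρ
  have := h.flat hfree
  have := h.surjective hfree
  have := h.quasiCompact
  refine ⟨X, π, h.isInvariant, ?_, fun hM => ?_, h.isCategoricalQuotient hfree,
    h.isFpqcTorsor hfree _, h.isAffineHom, fun U => ⟨h.injective_pullSection U,
      h.range_pullSection U, SchemeQuotient.invariantSections_eq_gradedPiece ρ U⟩,
    h.isOfFiniteType, h.isOfFinitePresentation⟩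
  · exact h.representsQuotientSheaf hfree _ _ fun s => Precoverage.generate_mem_toGrothendieck
      (Scheme.Hom.singleton_mem_fpqcPrecoverage (Limits.pullback.snd π.left s))
  -- Finite generation of `M` enters here only: it makes `π` locally of finite presentation, hence
  -- its base changes fppf coverings.
  · have := h.locallyOfFinitePresentation hfree
    exact h.representsQuotientSheaf hfree _ _ fun s => Precoverage.generate_mem_toGrothendieck
      (Scheme.Hom.singleton_mem_fppfPrecoverage (Limits.pullback.snd π.left s))
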